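/- There are an integer $c\ge 1$, a constant $C\ge 1$, a randomized word-RAM program $\mathsf{Pre}$ and a deterministic word-RAM program $\mathsf{Query}$ such that, writing $L(n) = C\,(\lfloor\log_2 n\rfloor+1)^{C}$, the following holds for all integers $1\le \ell\le k\le n$ and every finite alphabet $\Sigma$. The machine has words of $c\cdot(|n|_2+|\Sigma|_2)$ bits, where $|m|_2$ is the number of binary digits of $m$; arithmetic, comparisons, reading and writing an array entry, and drawing a uniformly random word take unit time; the numbers $n,k,\ell,|\Sigma|$ are given to both programs. $\operatorname{ED}$ is the edit distance (the least number of insertions, deletions and substitutions of single characters). 1. (Preprocessing.) For every $A\in\Sigma^n$, the expected running time of $\mathsf{Pre}$ on $A$ is at most $L(n)\cdot nk/\ell$, i.e. $\tilde O(nk/\ell)$. 2. (Query.) Let $A,B\in\Sigma^n$, and let $\mathsf{Pre}$ be run separately on $A$ and on $B$, the two runs using the same random tape. $\mathsf{Query}$ has access to $A$, $B$ and the two outputs of $\mathsf{Pre}$. Whenever both runs of $\mathsf{Pre}$ halt, $\mathsf{Query}$ halts after at most $L(n)\cdot k^2/\ell$ steps, i.e. in $\tilde O(k^2/\ell)$ time.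 3. (Correctness.) Over the random bits of the preprocessing: if $\operatorname{ED}(A,B)\le k/L(n)$, then with probability at least $1-\frac1n$ all runs halt and $\mathsf{Query}$ answers SMALL; if $\operatorname{ED}(A,B)\ge C k\ell$, then with probability at least $1-\frac1n$ all runs halt and $\mathsf{Query}$ answers LARGE. -/

import Mathlib

open MeasureTheory
open scoped ENNReal

/-! ### Edit distance -/

/-- `EditScript x y d`: reading from left to right, `x` can be turned into `y` with `d` insertions,
deletions and substitutions of single characters (keeping a character is free). -/
inductive EditScript {α : Type*} : List α → List α → ℕ → Prop
  | nil : EditScript [] [] 0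
  | keep {x y : List α} {d : ℕ} (a : α) : EditScript x y d → EditScript (a :: x) (a :: y) d
  | subst {x y : List α} {d : ℕ} (a b : α) :
      EditScript x y d → EditScript (a :: x) (b :: y) (d + 1)
  | delete {x y : List α} {d : ℕ} (a : α) : EditScript x y d → EditScript (a :: x) y (d + 1)
  | insert {x y : List α} {d : ℕ} (b : α) : EditScript x y d → EditScript x (b :: y) (d + 1)

/-- Some edit script always exists, so the infimum in `editDist` is a minimum. -/
theorem EditScript.exists_script {α : Type*} (x y : List α) : ∃ d, EditScript x y d := by
  induction x with
  | nil =>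
    induction y with
    | nil => exact ⟨0, .nil⟩
    | cons b y ih => obtain ⟨d, h⟩ := ih; exact ⟨d + 1, h.insert b⟩
  | cons a x ih => obtain ⟨d, h⟩ := ih; exact ⟨d + 1, h.delete a⟩

/-- The edit distance of two strings: the least number of single-character insertions, deletions
and substitutions that turn one into the other. -/
noncomputable def editDist {α : Type*} {n m : ℕ} (A : Fin n → α) (B : Fin m → α) : ℕ :=
  sInf {d | EditScript (List.ofFn A) (List.ofFn B) d}

/-! ### A randomized word RAM

All values are words of `w` bits (numbers below `2 ^ w`).  A program uses finitely many registers
and finitely many arrays, each array being indexed by words.  Random words are read one after the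
other from a tape of independent uniform words. -/

/-- The unit-cost operations on words.  Comparisons return `1` (true) or `0` (false). -/
inductive WordOp
  | add | sub | mul | div | mod | lt | eq

/-- Arithmetic is modulo `2 ^ w`; division by `0` returns `0`, and `a mod 0 = a`. -/
def WordOp.eval (w : ℕ) : WordOp → ℕ → ℕ → ℕ
  | .add, a, b => (a + b) % 2 ^ w
  | .sub, a, b => (a + (2 ^ w - b % 2 ^ w)) % 2 ^ w
  | .mul, a, b => (a * b) % 2 ^ w
  | .div, a, b => (a / b) % 2 ^ w
  | .mod, a, b => (a % b) % 2 ^ w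
  | .lt, a, b => (if a < b then 1 else 0) % 2 ^ w
  | .eq, a, b => (if a = b then 1 else 0) % 2 ^ w

/-- Programs.  Registers and arrays are named by numerals that occur in the program text. -/
inductive Prog
  | skip
  /-- `x := v`, for a numeral `v` of the program text -/
  | const (x v : ℕ)
  /-- `x := y op z`, for registers `x`, `y`, `z` -/
  | op (o : WordOp) (x y z : ℕ)
  /-- `x := b[y]`, for registers `x`, `y` and the array `b` -/
  | load (x b y : ℕ)
  /-- `b[y] := x`, for registers `x`, `y` and the array `b` -/
  | store (b y x : ℕ)
  /-- `x :=` the next random word -/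
  | rand (x : ℕ)
  | seq (p q : Prog)
  /-- run `p` if register `x` is nonzero, else `q` -/
  | ite (x : ℕ) (p q : Prog)
  /-- repeat `p` as long as register `x` is nonzero -/
  | while (x : ℕ) (p : Prog)

/-- The program uses no randomness. -/
def Prog.Deterministic : Prog → Prop
  | .rand _ => False
  | .seq p q => p.Deterministic ∧ q.Deterministic
  | .ite _ p q => p.Deterministic ∧ q.Deterministic
  | .while _ p => p.Deterministic
  | _ => True

/-- A configuration of the machine: the registers, the arrays (`mem b i` is entry `i` of array `b`)
and the number of random words read so far. -/
structure Config where
  reg : ℕ → ℕ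
  mem : ℕ → ℕ → ℕ
  pos : ℕ

/-- The configuration after `x := v`. -/
def Config.setReg (s : Config) (x v : ℕ) : Config :=
  { s with reg := Function.update s.reg x v }

/-- The configuration after `b[i] := v`. -/
def Config.setMem (s : Config) (b i v : ℕ) : Config :=
  { s with mem := Function.update s.mem b (Function.update (s.mem b) i v) }

/-- A tape of random `w`-bit words. -/
abbrev Tape (w : ℕ) : Type := ℕ → Fin (2 ^ w)

/-- `Exec w ω p s t s'`: with word length `w` and random tape `ω`, the program `p` started in `s`
halts in `s'` after exactly `t` steps.  Each instruction and each test costs one step. -/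
inductive Exec (w : ℕ) (ω : Tape w) : Prog → Config → ℕ → Config → Prop
  | skip (s : Config) : Exec w ω .skip s 1 s
  | const (s : Config) (x v : ℕ) : Exec w ω (.const x v) s 1 (s.setReg x (v % 2 ^ w))
  | op (s : Config) (o : WordOp) (x y z : ℕ) :
      Exec w ω (.op o x y z) s 1 (s.setReg x (o.eval w (s.reg y) (s.reg z)))
  | load (s : Config) (x b y : ℕ) : Exec w ω (.load x b y) s 1 (s.setReg x (s.mem b (s.reg y)))
  | store (s : Config) (b y x : ℕ) :
      Exec w ω (.store b y x) s 1 (s.setMem b (s.reg y) (s.reg x))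
  | rand (s : Config) (x : ℕ) :
      Exec w ω (.rand x) s 1 { s.setReg x (ω s.pos) with pos := s.pos + 1 }
  | seq {p q : Prog} {s s' s'' : Config} {t t' : ℕ} :
      Exec w ω p s t s' → Exec w ω q s' t' s'' → Exec w ω (.seq p q) s (t + t') s''
  | iteTrue {x : ℕ} {p q : Prog} {s s' : Config} {t : ℕ} :
      s.reg x ≠ 0 → Exec w ω p s t s' → Exec w ω (.ite x p q) s (t + 1) s'
  | iteFalse {x : ℕ} {p q : Prog} {s s' : Config} {t : ℕ} :
      s.reg x = 0 → Exec w ω q s t s' → Exec w ω (.ite x p q) s (t + 1) s'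
  | whileTrue {x : ℕ} {p : Prog} {s s' s'' : Config} {t t' : ℕ} :
      s.reg x ≠ 0 → Exec w ω p s t s' → Exec w ω (.while x p) s' t' s'' →
      Exec w ω (.while x p) s (t + t' + 1) s''
  | whileFalse {x : ℕ} {p : Prog} {s : Config} :
      s.reg x = 0 → Exec w ω (.while x p) s 1 s

/-- Once the tape is fixed, the running time and the final configuration are determined. -/
theorem Exec.unique {w : ℕ} {ω : Tape w} {p : Prog} {s s₁ s₂ : Config} {t₁ t₂ : ℕ}
    (h₁ : Exec w ω p s t₁ s₁) (h₂ : Exec w ω p s t₂ s₂) : t₁ = t₂ ∧ s₁ = s₂ := by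
  induction h₁ generalizing t₂ s₂ with
  | seq _ _ ih ih' =>
    cases h₂ with
    | seq a b => obtain ⟨rfl, rfl⟩ := ih a; obtain ⟨rfl, rfl⟩ := ih' b; exact ⟨rfl, rfl⟩
  | iteTrue hx _ ih =>
    cases h₂ with
    | iteTrue _ a => obtain ⟨rfl, rfl⟩ := ih a; exact ⟨rfl, rfl⟩
    | iteFalse hx' _ => exact absurd hx' hx
  | iteFalse hx _ ih =>
    cases h₂ with
    | iteTrue hx' _ => exact absurd hx hx'
    | iteFalse _ a => obtain ⟨rfl, rfl⟩ := ih a; exact ⟨rfl, rfl⟩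
  | whileTrue hx _ _ ih ih' =>
    cases h₂ with
    | whileTrue _ a b => obtain ⟨rfl, rfl⟩ := ih a; obtain ⟨rfl, rfl⟩ := ih' b; exact ⟨rfl, rfl⟩
    | whileFalse hx' => exact absurd hx' hx
  | whileFalse hx =>
    cases h₂ with
    | whileTrue hx' _ _ => exact absurd hx hx'
    | whileFalse _ => exact ⟨rfl, rfl⟩
  | _ => cases h₂; exact ⟨rfl, rfl⟩

/-- The running time of `p` started in `s`; it is `∞` if `p` does not halt. -/
noncomputable def runTime (w : ℕ) (ω : Tape w) (p : Prog) (s : Config) : ℝ≥0∞ :=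
  ⨅ (t : ℕ) (s' : Config) (_ : Exec w ω p s t s'), (t : ℝ≥0∞)

/-- The law of the random tape: independent uniformly distributed `w`-bit words. -/
noncomputable def tapeLaw (w : ℕ) : Measure (Tape w) :=
  Measure.infinitePi fun _ => (PMF.uniformOfFintype (Fin (2 ^ w))).toMeasure

/-- The word length for strings of length `n` over an alphabet of `σ` characters, a multiple of
(the number of binary digits of `n`) + (the number of binary digits of `σ`). -/
def wordLength (c n σ : ℕ) : ℕ := c * (Nat.size n + Nat.size σ)

/-! ### Two-sided preprocessing -/

/-- A string as the contents of an array. -/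
def stringArray {n σ : ℕ} (A : Fin n → Fin σ) : ℕ → ℕ :=
  fun i => if h : i < n then (A ⟨i, h⟩ : ℕ) else 0

/-- The parameters are handed over in the first four registers; all others are `0`. -/
def paramRegs (n k l σ : ℕ) : ℕ → ℕ
  | 0 => n
  | 1 => k
  | 2 => l
  | 3 => σ
  | _ => 0

/-- Start of the preprocessing of one string: array `0` holds the string, all others are `0`. -/
def preInit {n σ : ℕ} (k l : ℕ) (A : Fin n → Fin σ) : Config where
  reg := paramRegs n k l σ
  mem
    | 0 => stringArray A
    | _ => fun _ => 0
  pos := 0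

/-- `PreOut w ω pre k l A D`: run on the string `A` with the random tape `ω`, the preprocessing
halts with output `D`, the final contents of array `1`. -/
def PreOut (w : ℕ) (ω : Tape w) (pre : Prog) {n σ : ℕ} (k l : ℕ) (A : Fin n → Fin σ)
    (D : ℕ → ℕ) : Prop :=
  ∃ t s, Exec w ω pre (preInit k l A) t s ∧ s.mem 1 = D

/-- Start of a query: arrays `0` and `1` hold the two strings, arrays `2` and `3` hold the outputs
of their preprocessing, all others are `0`. -/
def queryInit {n σ : ℕ} (k l : ℕ) (A B : Fin n → Fin σ) (DA DB : ℕ → ℕ) : Config where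
  reg := paramRegs n k l σ
  mem
    | 0 => stringArray A
    | 1 => stringArray B
    | 2 => DA
    | 3 => DB
    | _ => fun _ => 0
  pos := 0

/-- With the random tape `ω`, both runs of the preprocessing (one on `A`, one on `B`, both reading
the tape from its beginning) and the query halt, and the query leaves the answer `ans` in
register `0`. -/
def Answers (w : ℕ) (ω : Tape w) (pre query : Prog) {n σ : ℕ} (k l : ℕ) (A B : Fin n → Fin σ)
    (ans : ℕ) : Prop :=
  ∃ DA DB t s, PreOut w ω pre k l A DA ∧ PreOut w ω pre k l B DB ∧
    Exec w ω query (queryInit k l A B DA DB) t s ∧ s.reg 0 = ans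

/-- A polylogarithmic factor `C * (⌊log₂ n⌋ + 1) ^ C`. -/
def polylog (C n : ℕ) : ℕ := C * (Nat.log 2 n + 1) ^ C

/-!
Group the diagonals of the edit graph into `2 k / l + 1` blocks of `l` neighbouring diagonals, and
advance on each block a front, a position of the first string, in `k` rounds.  In one round the
front of a block is replaced by the best front of the block and its two neighbours, jumps over the
longest common window of dyadic length that starts there on some diagonal near the block, and passes
one more character.

*Close strings.*  The largest power of two below a number exceeds its half, so `⌊log₂ n⌋ + 1` rounds
pass a common stretch of an optimal alignment, and one more round passes an edit.  Hence some front
reaches the end within `k` rounds if the edit distance is below `k / (3 (⌊log₂ n⌋ + 1))`.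

*Far strings.*  The front of a block never strays from its diagonals by more than `O(l)`, so every
round costs `O(l)` edits, and a front that reaches the end within `k` rounds yields a script of
`O(k l)` edits.

*Finding the windows.*  The preprocessing of a string enters every dyadic window into a table, keyed
by its length, by the grid cell of width `l` of its position, and by a fingerprint.  A common window
on some diagonal near a block is then found by two look-ups.  Fingerprints are computed by
multiplicative hashing of the fingerprints of the two halves of a window; both strings use the same
random multipliers, equal windows have equal fingerprints, and the union bound over all pairs of
windows makes a false match unlikely.
-/

/-! ### Compiled expressions and timed Hoare triples -/

infixr:60 " ;; " => Prog.seq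

namespace Config

@[simp]
theorem setReg_reg (h : Config) (x v y : ℕ) :
    (h.setReg x v).reg y = if y = x then v else h.reg y :=
  Function.update_apply ..

/-- The two configurations agree except for the registers from `d` on. -/
structure AgreeBelow (d : ℕ) (s h : Config) : Prop where
  reg : ∀ r < d, s.reg r = h.reg r
  mem : s.mem = h.mem
  pos : s.pos = h.pos

namespace AgreeBelow

variable {d d' x : ℕ} {s s' h : Config}

theorem refl : h.AgreeBelow d h := ⟨fun _ _ => rfl, rfl, rfl⟩

theorem trans (hs : s.AgreeBelow d s') (hs' : s'.AgreeBelow d h) : s.AgreeBelow d h :=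
  ⟨fun r hr => (hs.reg r hr).trans (hs'.reg r hr), hs.mem.trans hs'.mem, hs.pos.trans hs'.pos⟩

theorem mono (hs : s.AgreeBelow d' h) (hd : d ≤ d') : s.AgreeBelow d h :=
  ⟨fun r hr => hs.reg r (hr.trans_le hd), hs.mem, hs.pos⟩

theorem setReg (hs : s.AgreeBelow d h) (hx : d ≤ x) {v : ℕ} : (s.setReg x v).AgreeBelow d h :=
  ⟨fun r hr => by rw [setReg_reg, if_neg (by omega), hs.reg r hr], hs.mem, hs.pos⟩

end AgreeBelow

end Config

theorem WordOp.eval_lt (w : ℕ) (o : WordOp) (a b : ℕ) : o.eval w a b < 2 ^ w := by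
  cases o <;> exact Nat.mod_lt _ (by positivity)

/-- Registers from this one on hold the intermediate results of compiled expressions. -/
abbrev scratch : ℕ := 32

/-- Arithmetic expressions over registers, numerals and array entries. -/
inductive WordExp
  | reg (x : ℕ)
  | num (v : ℕ)
  | op (o : WordOp) (a b : WordExp)
  | max (a b : WordExp)
  | get (arr : ℕ) (i : WordExp)

namespace WordExp

instance : Add WordExp := ⟨op .add⟩
instance : Sub WordExp := ⟨op .sub⟩
instance : Mul WordExp := ⟨op .mul⟩
instance : Div WordExp := ⟨op .div⟩
instance (v : ℕ) : OfNat WordExp v := ⟨num v⟩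

/-- Code that computes the expression into register `d`, using only registers from `d` on. -/
def comp : WordExp → ℕ → Prog
  | reg x, d => .const d 0 ;; .op .add d x d
  | num v, d => .const d v
  | op o a b, d => a.comp d ;; b.comp (d + 1) ;; .op o d d (d + 1)
  | max a b, d => a.comp d ;; b.comp (d + 1) ;; .op .lt (d + 2) d (d + 1) ;;
      .ite (d + 2) (.const (d + 2) 0 ;; .op .add d (d + 1) (d + 2)) .skip
  | get arr i, d => i.comp d ;; .load d arr d

/-- A bound on the running time of the compiled code. -/
def cost : WordExp → ℕ
  | reg _ => 2
  | num _ => 1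
  | op _ a b => a.cost + (b.cost + 1)
  | max a b => a.cost + (b.cost + 4)
  | get _ i => i.cost + 1

theorem comp_deterministic (e : WordExp) (d : ℕ) : (e.comp d).Deterministic := by
  induction e generalizing d <;> simp_all [comp, Prog.Deterministic]

/-- `e.Evals w h v`: in the configuration `h`, the expression `e` only refers to registers below
`scratch` and has the value `v`, which is a word, as are all intermediate results. -/
inductive Evals (w : ℕ) (h : Config) : WordExp → ℕ → Prop
  | reg {x v : ℕ} (hr : h.reg x = v) (hv : v < 2 ^ w := by omega)
      (hx : x < scratch := by decide) :
      Evals w h (.reg x) v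
  | num {v : ℕ} (hv : v < 2 ^ w) : Evals w h (.num v) v
  | op {a b : WordExp} {u v : ℕ} (o : WordOp) :
      Evals w h a u → Evals w h b v → Evals w h (.op o a b) (o.eval w u v)
  | max {a b : WordExp} {u v : ℕ} :
      Evals w h a u → Evals w h b v → Evals w h (.max a b) (Max.max u v)
  | get {i : WordExp} {arr u v : ℕ} :
      Evals w h i u → h.mem arr u = v → v < 2 ^ w → Evals w h (.get arr i) v

namespace Evals

variable {w : ℕ} {h s : Config} {a b e : WordExp} {u v z : ℕ}

theorem lt (he : e.Evals w h v) : v < 2 ^ w := by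
  induction he with
  | reg _ hv => exact hv
  | num hv => exact hv
  | op o => exact o.eval_lt ..
  | max _ _ iha ihb => exact max_lt iha ihb
  | get _ _ hv => exact hv

theorem ofNat {v : ℕ} (hv : (OfNat.ofNat v : ℕ) < 2 ^ w := by omega) :
    (OfNat.ofNat v : WordExp).Evals w h (OfNat.ofNat v : ℕ) := .num hv

theorem add (ha : a.Evals w h u) (hb : b.Evals w h v) (hz : u + v = z)
    (hw : z < 2 ^ w := by omega) :
    (a + b).Evals w h z := by
  subst hz; exact Nat.mod_eq_of_lt hw ▸ ha.op .add hb

theorem sub (ha : a.Evals w h u) (hb : b.Evals w h v) (hz : z + v = u) :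
    (a - b).Evals w h z := by
  have hu := ha.lt
  have heval : WordOp.sub.eval w u v = z := by
    rw [WordOp.eval, Nat.mod_eq_of_lt hb.lt, show u + (2 ^ w - v) = z + 2 ^ w by omega,
      Nat.add_mod_right, Nat.mod_eq_of_lt (by omega)]
  exact heval ▸ ha.op .sub hb

theorem mul (ha : a.Evals w h u) (hb : b.Evals w h v) (hz : u * v = z)
    (hw : z < 2 ^ w := by omega) :
    (a * b).Evals w h z := by
  subst hz; exact Nat.mod_eq_of_lt hw ▸ ha.op .mul hb

theorem div (ha : a.Evals w h u) (hb : b.Evals w h v) : (a / b).Evals w h (u / v) :=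
  Nat.mod_eq_of_lt ((Nat.div_le_self u v).trans_lt ha.lt) ▸ ha.op .div hb

theorem ite_mod_two_pow (P : Prop) [Decidable P] (hw : 0 < w) :
    (if P then 1 else 0) % 2 ^ w = if P then 1 else 0 := by
  have := Nat.one_lt_two_pow hw.ne'
  split_ifs <;> exact Nat.mod_eq_of_lt (by omega)

theorem compareLT (ha : a.Evals w h u) (hb : b.Evals w h v) (hw : 0 < w) :
    (WordExp.op .lt a b).Evals w h (if u < v then 1 else 0) :=
  ite_mod_two_pow (u < v) hw ▸ ha.op .lt hb

theorem compareEq (ha : a.Evals w h u) (hb : b.Evals w h v) (hw : 0 < w) :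
    (WordExp.op .eq a b).Evals w h (if u = v then 1 else 0) :=
  ite_mod_two_pow (u = v) hw ▸ ha.op .eq hb

end Evals

/-- Started in `h`, the program `p` leaves the word `v` in register `d` after at most `T` steps,
without touching any lower register or any array. -/
def Leaves {w : ℕ} (ω : Tape w) (p : Prog) (h : Config) (d v T : ℕ) : Prop :=
  ∃ t s, Exec w ω p h t s ∧ t ≤ T ∧ s.reg d = v ∧ s.AgreeBelow d h

namespace Leaves

variable {w : ℕ} {ω : Tape w} {p q : Prog} {h : Config} {d u v T T' : ℕ}

theorem of_exec {t : ℕ} {s : Config} (he : Exec w ω p h t s) (ht : t ≤ T) (hv : s.reg d = v)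
    (hs : s.AgreeBelow d h) : Leaves ω p h d v T :=
  ⟨t, s, he, ht, hv, hs⟩

theorem op (o : WordOp) (hp : Leaves ω p h d u T)
    (hq : ∀ s, s.AgreeBelow d h → Leaves ω q s (d + 1) v T') :
    Leaves ω (p ;; q ;; .op o d d (d + 1)) h d (o.eval w u v) (T + (T' + 1)) := by
  obtain ⟨t, s, ep, ht, hu, hs⟩ := hp
  obtain ⟨t', s', eq, ht', hv, hs'⟩ := hq s hs
  refine of_exec (ep.seq (eq.seq (.op ..))) (by omega) ?_ (.setReg ?_ le_rfl)
  · simp [hs'.reg, hu, hv]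
  · exact (hs'.mono d.le_succ).trans hs

theorem max (hp : Leaves ω p h d u T) (hq : ∀ s, s.AgreeBelow d h → Leaves ω q s (d + 1) v T')
    (hv : v < 2 ^ w) :
    Leaves ω (p ;; q ;; .op .lt (d + 2) d (d + 1) ;;
      .ite (d + 2) (.const (d + 2) 0 ;; .op .add d (d + 1) (d + 2)) .skip)
      h d (Max.max u v) (T + (T' + 4)) := by
  obtain ⟨t, s, ep, ht, hsu, hs⟩ := hp
  obtain ⟨t', s', eq, ht', hsv, hs'⟩ := hq s hs
  have hsu' : s'.reg d = u := (hs'.reg d d.lt_succ_self).trans hsu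
  have hagree : s'.AgreeBelow d h := (hs'.mono d.le_succ).trans hs
  have hlt : WordOp.lt.eval w u v ≠ 0 ↔ u < v := by
    rcases Nat.eq_zero_or_pos w with rfl | hw
    · simp only [WordOp.eval]; omega
    · simp [WordOp.eval, Evals.ite_mod_two_pow _ hw]
  by_cases huv : u < v
  · refine of_exec (ep.seq (eq.seq (.seq (.op ..) (.iteTrue ?_ (.seq (.const ..) (.op ..))))))
      (by omega) ?_ ?_
    · simpa [hsu', hsv] using hlt.2 huv
    · simpa [WordOp.eval, hsv, huv.le] using Nat.mod_eq_of_lt hv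
    · exact ((hagree.setReg (by omega)).setReg (by omega)).setReg le_rfl
  · refine of_exec (ep.seq (eq.seq (.seq (.op ..) (.iteFalse ?_ (.skip _))))) (by omega) ?_ ?_
    · simpa [hsu', hsv] using mt hlt.1 huv
    · simpa [hsu'] using not_lt.1 huv
    · exact hagree.setReg (by omega)

end Leaves

theorem Evals.leaves_comp {w : ℕ} (ω : Tape w) {s h : Config} {e : WordExp} {v d : ℕ}
    (he : e.Evals w h v) (hs : s.AgreeBelow scratch h) (hd : scratch ≤ d) :
    Leaves ω (e.comp d) s d v e.cost := by
  induction he generalizing s d with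
  | @reg x v hr hv hx =>
    have hxd : x ≠ d := by omega
    refine .of_exec (.seq (.const ..) (.op ..)) le_rfl ?_ (.setReg (.setReg .refl le_rfl) le_rfl)
    simpa [WordOp.eval, hxd, hs.reg x hx, hr] using Nat.mod_eq_of_lt hv
  | num hv =>
    exact .of_exec (.const ..) le_rfl (by simpa using Nat.mod_eq_of_lt hv) (.setReg .refl le_rfl)
  | op o _ _ iha ihb =>
    exact (iha hs hd).op o fun s' hs' => ihb ((hs'.mono hd).trans hs) (by omega)
  | max _ hb iha ihb =>
    exact (iha hs hd).max (fun s' hs' => ihb ((hs'.mono hd).trans hs) (by omega)) hb.lt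
  | get _ hget _ ih =>
    obtain ⟨t, s', es, ht, hu, hs'⟩ := ih hs hd
    refine .of_exec (es.seq (.load ..)) (Nat.succ_le_succ ht) ?_ (hs'.setReg le_rfl)
    simp [hu, hs'.mem, hs.mem, hget]

end WordExp

/-- The assignment `x := e`. -/
def assign (x : ℕ) (e : WordExp) : Prog :=
  e.comp scratch ;; .const (scratch + 1) 0 ;; .op .add x scratch (scratch + 1)

/-- The assignment `arr[i] := e`. -/
def put (arr : ℕ) (i e : WordExp) : Prog :=
  i.comp scratch ;; e.comp (scratch + 1) ;; .store arr scratch (scratch + 1)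

infix:61 " ::= " => assign

theorem assign_deterministic (x : ℕ) (e : WordExp) : (x ::= e).Deterministic :=
  ⟨e.comp_deterministic _, trivial, trivial⟩

theorem put_deterministic (arr : ℕ) (i e : WordExp) : (put arr i e).Deterministic :=
  ⟨i.comp_deterministic _, e.comp_deterministic _, trivial⟩

/-- A timed Hoare triple: started in `h`, up to intermediate results of expressions, the program
halts after at most `T` steps in a configuration that satisfies `Q`, again up to intermediate
results. -/
def HaltsWithin {w : ℕ} (ω : Tape w) (p : Prog) (h : Config) (T : ℕ) (Q : Config → Prop) : Prop :=
  ∀ s : Config, s.AgreeBelow scratch h →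
    ∃ t s' h', Exec w ω p s t s' ∧ t ≤ T ∧ s'.AgreeBelow scratch h' ∧ Q h'

namespace HaltsWithin

variable {w : ℕ} {ω : Tape w} {p q : Prog} {h : Config} {T T' : ℕ} {Q R : Config → Prop}

theorem mono (H : HaltsWithin ω p h T Q) (hT : T ≤ T') (hQ : ∀ h', Q h' → R h') :
    HaltsWithin ω p h T' R := fun s hs =>
  let ⟨t, s', h', e, ht, hs', hq⟩ := H s hs
  ⟨t, s', h', e, ht.trans hT, hs', hQ _ hq⟩

theorem of_le (hT : T ≤ T') (H : HaltsWithin ω p h T Q) : HaltsWithin ω p h T' Q :=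
  H.mono hT fun _ => id

theorem seq (H : HaltsWithin ω p h T R) (H' : ∀ h', R h' → HaltsWithin ω q h' T' Q) :
    HaltsWithin ω (p ;; q) h (T + T') Q := fun s hs =>
  let ⟨_, s', h', e, ht, hs', hr⟩ := H s hs
  let ⟨_, s'', h'', e', ht', hs'', hq⟩ := H' h' hr s' hs'
  ⟨_, s'', h'', e.seq e', add_le_add ht ht', hs'', hq⟩

theorem assign {x v : ℕ} {e : WordExp} (he : e.Evals w h v) (hQ : Q (h.setReg x v)) :
    HaltsWithin ω (x ::= e) h (e.cost + 2) Q := fun s hs => by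
  obtain ⟨t, s', ex, ht, hv, hs'⟩ := he.leaves_comp ω hs le_rfl
  refine ⟨_, _, _, ex.seq (.seq (.const ..) (.op ..)), by omega, ⟨fun y hy => ?_, ?_, ?_⟩, hQ⟩
  · by_cases hxy : y = x
    · simpa [hxy, WordOp.eval, hv] using Nat.mod_eq_of_lt he.lt
    · simp [hxy, (hy.trans (Nat.lt_succ_self scratch)).ne, hs'.reg y hy, hs.reg y hy]
  · exact hs'.mem.trans hs.mem
  · exact hs'.pos.trans hs.pos

theorem assign_seq {x v : ℕ} {e : WordExp} (he : e.Evals w h v)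
    (H : HaltsWithin ω q (h.setReg x v) T Q) :
    HaltsWithin ω (x ::= e ;; q) h (e.cost + 2 + T) Q :=
  (assign (Q := (· = h.setReg x v)) he rfl).seq fun _ h' => h' ▸ H

theorem put {arr a v : ℕ} {i e : WordExp} (hi : i.Evals w h a) (he : e.Evals w h v)
    (hQ : Q (h.setMem arr a v)) :
    HaltsWithin ω (put arr i e) h (i.cost + e.cost + 1) Q := fun s hs => by
  obtain ⟨t, s', ex, ht, ha, hs'⟩ := hi.leaves_comp ω hs le_rfl
  obtain ⟨t', s'', ex', ht', hv, hs''⟩ :=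
    he.leaves_comp ω (hs'.trans hs) (Nat.le_succ scratch)
  have ha' : s''.reg scratch = a := (hs''.reg _ (Nat.lt_succ_self _)).trans ha
  have hagree : s''.AgreeBelow scratch h := ((hs''.mono (Nat.le_succ _)).trans hs').trans hs
  refine ⟨_, _, h.setMem arr a v, ex.seq (ex'.seq (.store ..)), by omega,
    ⟨hagree.reg, ?_, hagree.pos⟩, hQ⟩
  simp only [Config.setMem, ha', hv, hagree.mem]

theorem put_seq {arr a v : ℕ} {i e : WordExp} (hi : i.Evals w h a) (he : e.Evals w h v)
    (H : HaltsWithin ω q (h.setMem arr a v) T Q) :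
    HaltsWithin ω (_root_.put arr i e ;; q) h (i.cost + e.cost + 1 + T) Q :=
  (put (Q := (· = h.setMem arr a v)) hi he rfl).seq fun _ h' => h' ▸ H

theorem rand_seq {x : ℕ}
    (H : HaltsWithin ω q { h.setReg x (ω h.pos) with pos := h.pos + 1 } T Q) :
    HaltsWithin ω (.rand x ;; q) h (1 + T) Q := by
  refine seq (R := (· = { h.setReg x (ω h.pos) with pos := h.pos + 1 }))
    (fun s hs => ⟨_, _, _, .rand .., le_rfl, ⟨fun y hy => ?_, ?_, ?_⟩, rfl⟩) fun _ h' => h' ▸ H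
  · simp [hs.pos, hs.reg y hy]
  · exact hs.mem
  · simp [hs.pos]

/-- The rule for loops: `Inv m` is the invariant when `m` more rounds are to be made. -/
theorem loop {x : ℕ} (Inv : ℕ → Config → Prop) (h_zero : ∀ h, Inv 0 h → h.reg x = 0)
    (h_succ : ∀ m h, Inv (m + 1) h → h.reg x ≠ 0)
    (H : ∀ m h, Inv (m + 1) h → HaltsWithin ω p h T (Inv m)) {m : ℕ} (hm : Inv m h)
    (hx : x < scratch := by decide) :
    HaltsWithin ω (.while x p) h (m * (T + 1) + 1) (Inv 0) := by
  induction m generalizing h with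
  | zero =>
    exact fun s hs =>
      ⟨_, s, h, .whileFalse ((hs.reg x hx).trans (h_zero h hm)), by omega, hs, hm⟩
  | succ m ih =>
    intro s hs
    obtain ⟨t, s', h', e, ht, hs', hm'⟩ := H m h hm s hs
    obtain ⟨t', s'', h'', e', ht', hs'', h0⟩ := ih hm' s' hs'
    have hx' : s.reg x ≠ 0 := by rw [hs.reg x hx]; exact h_succ m h hm
    exact ⟨_, s'', h'', e.whileTrue hx' e', by rw [Nat.succ_mul]; omega, hs'', h0⟩

end HaltsWithin

/-! ### Multiplicative hashing -/

/-- Multiplicative hashing with multiplier `r`: the leading digits of `r * z` modulo `W`. -/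
def mulHash (W D r z : ℕ) : ℕ := r * z % W / D

theorem mulHash_le {W : ℕ} (hW : 0 < W) (D r z : ℕ) : mulHash W D r z ≤ (W - 1) / D :=
  Nat.div_le_div_right (Nat.le_sub_one_of_lt (Nat.mod_lt _ hW))

theorem exists_abs_mul_sub_lt_of_mulHash_eq {W D r z δ : ℕ} (hD : 0 < D) (hr : r < W)
    (h : mulHash W D r (z + δ) = mulHash W D r z) :
    ∃ q ≤ δ, |(r * δ - q * W : ℤ)| < D := by
  set a := r * (z + δ) % W
  set b := r * z % W
  have ha : W * (r * (z + δ) / W) + a = r * (z + δ) := Nat.div_add_mod _ _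
  have hb : W * (r * z / W) + b = r * z := Nat.div_add_mod _ _
  have hab : |(a - b : ℤ)| < D := by
    have ha' := Nat.div_add_mod a D
    have hb' := Nat.div_add_mod b D
    have haD := Nat.mod_lt a hD
    have hbD := Nat.mod_lt b hD
    rw [show a / D = b / D from h] at ha'
    rw [abs_lt]; omega
  obtain ⟨q, hq⟩ := Nat.exists_eq_add_of_le
    (Nat.div_le_div_right (c := W) (Nat.mul_le_mul_left r (z.le_add_right δ)))
  have hrδ : (r * δ - q * W : ℤ) = a - b := by
    rw [hq] at ha
    zify at ha hb
    linarith
  refine ⟨q, ?_, hrδ ▸ hab⟩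
  have hbW : b < W := Nat.mod_lt _ (by omega)
  have hqW : (q * W : ℤ) < (δ + 1) * W := by
    have : (r * δ : ℤ) ≤ W * δ := by gcongr
    linarith [(by exact_mod_cast hbW : (b : ℤ) < W), (by positivity : (0 : ℤ) ≤ a)]
  exact Nat.lt_succ_iff.1 (by exact_mod_cast lt_of_mul_lt_mul_right hqW (by positivity))

theorem card_abs_mul_sub_lt_le {δ : ℕ} (hδ : 0 < δ) (W D : ℕ) (c : ℤ) :
    (Finset.univ.filter fun r : Fin W => |(r * δ - c : ℤ)| < D).card ≤ 2 * D / δ + 1 := by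
  set S := Finset.univ.filter fun r : Fin W => |(r * δ - c : ℤ)| < D with hS
  obtain hempty | hne := S.eq_empty_or_nonempty
  · simp [hempty]
  set a := S.min' hne
  have hsub : S.map Fin.valEmbedding ⊆ Finset.Icc (a : ℕ) (a + 2 * D / δ) := by
    intro _ hr'
    obtain ⟨r, hr, rfl⟩ := Finset.mem_map.1 hr'
    have har : a ≤ r := Finset.min'_le _ _ hr
    have ha : a ∈ S := Finset.min'_mem _ _
    obtain ⟨m, hm⟩ := Nat.exists_eq_add_of_le (Fin.le_def.1 har)
    have hm' : m * δ ≤ 2 * D := by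
      simp only [hS, Finset.mem_filter, Finset.mem_univ, true_and, abs_lt] at hr ha
      rw [hm] at hr
      push_cast at hr
      zify
      linarith
    have := (Nat.le_div_iff_mul_le hδ).2 hm'
    simp only [Fin.valEmbedding_apply, Finset.mem_Icc]
    omega
  calc S.card = (S.map Fin.valEmbedding).card := (Finset.card_map _).symm
    _ ≤ _ := Finset.card_le_card hsub
    _ = 2 * D / δ + 1 := by rw [Nat.card_Icc, add_assoc, Nat.add_sub_cancel_left]

theorem card_mulHash_eq_le {W D Z z z' : ℕ} (hD : 0 < D) (hz : z < Z) (hz' : z' < Z)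
    (hne : z ≠ z') :
    (Finset.univ.filter fun r : Fin W => mulHash W D r z = mulHash W D r z').card ≤
      4 * D + 2 * Z := by
  wlog hlt : z' < z generalizing z z'
  · simpa only [eq_comm] using this hz' hz hne.symm (by omega)
  obtain ⟨δ, hδ, rfl⟩ : ∃ δ, 0 < δ ∧ z = z' + δ := ⟨z - z', by omega, by omega⟩
  let S (q : ℕ) : Finset (Fin W) := Finset.univ.filter fun r => |(r * δ - q * W : ℤ)| < D
  have hsub : (Finset.univ.filter fun r : Fin W => mulHash W D r (z' + δ) = mulHash W D r z') ⊆
      (Finset.range (δ + 1)).biUnion S := by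
    intro r hr
    obtain ⟨q, hq, h⟩ := exists_abs_mul_sub_lt_of_mulHash_eq hD r.2 (Finset.mem_filter.1 hr).2
    simpa [S] using ⟨q, hq, h⟩
  calc _ ≤ _ := Finset.card_le_card hsub
    _ ≤ (Finset.range (δ + 1)).card * (2 * D / δ + 1) :=
        Finset.card_biUnion_le_card_mul _ _ _ fun q _ => card_abs_mul_sub_lt_le hδ W D (q * W)
    _ = 2 * D / δ * δ + 2 * D / δ + δ + 1 := by rw [Finset.card_range]; ring
    _ ≤ _ := by
        have := Nat.div_mul_le_self (2 * D) δ
        have := Nat.div_le_self (2 * D) δ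
        omega

section infinitePi

variable {ι α : Type*} [Fintype α] [Nonempty α] [MeasurableSpace α] [MeasurableSingletonClass α]

theorem infinitePi_uniformOfFintype_cylinder (s : Finset ι) (x : ι → α) :
    Measure.infinitePi (fun _ : ι => (PMF.uniformOfFintype α).toMeasure)
      {ω | ∀ i ∈ s, ω i = x i} = (Fintype.card α : ℝ≥0∞)⁻¹ ^ s.card := by
  have hpi : {ω : ι → α | ∀ i ∈ s, ω i = x i} = Set.pi s fun i => {x i} := by
    ext ω; simp [Set.mem_pi]
  rw [hpi, Measure.infinitePi_pi _ fun i _ => measurableSet_singleton _,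
    Finset.prod_congr rfl fun i _ => PMF.toMeasure_apply_singleton _ _ (measurableSet_singleton _)]
  simp

/-- The principle of deferred decisions: a set that does not depend on the coordinate `j` contains
it with the right probability. -/
theorem infinitePi_uniformOfFintype_mem_le {s : Finset ι} {j : ι} (hj : j ∉ s)
    {g : (ι → α) → Finset α} (hg : DependsOn g s) {K : ℕ} (hK : ∀ ω, (g ω).card ≤ K) :
    Measure.infinitePi (fun _ : ι => (PMF.uniformOfFintype α).toMeasure) {ω | ω j ∈ g ω} ≤
      (K : ℝ≥0∞) / Fintype.card α := by
  classical
  set μ := Measure.infinitePi fun _ : ι => (PMF.uniformOfFintype α).toMeasure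
  let extend (x : s → α) (v : α) : ι → α := fun i => if h : i ∈ s then x ⟨i, h⟩ else v
  let cylinder (x : s → α) (v : α) : Set (ι → α) := {ω | ∀ i ∈ insert j s, ω i = extend x v i}
  have hsub : {ω | ω j ∈ g ω} ⊆ ⋃ x ∈ (Finset.univ : Finset (s → α)),
      ⋃ v ∈ g (extend x (Classical.arbitrary α)), cylinder x v := by
    intro ω hω
    have hω' : g ω = g (extend (fun i => ω i) (Classical.arbitrary α)) :=
      hg fun i hi => by simp [extend, Finset.mem_coe.1 hi]
    simp only [Set.mem_iUnion]
    refine ⟨fun i => ω i, Finset.mem_univ _, ω j, hω' ▸ hω, fun i hi => ?_⟩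
    obtain rfl | hi := Finset.mem_insert.1 hi
    · simp [extend, hj]
    · simp [extend, hi]
  have hcard : (Fintype.card α : ℝ≥0∞) ≠ 0 := by simp
  calc μ {ω | ω j ∈ g ω} ≤ _ := measure_mono hsub
    _ ≤ ∑ x : s → α, μ (⋃ v ∈ g (extend x (Classical.arbitrary α)), cylinder x v) :=
        measure_biUnion_finset_le _ _
    _ ≤ ∑ _x : s → α, (K : ℝ≥0∞) * (Fintype.card α : ℝ≥0∞)⁻¹ ^ (s.card + 1) := by
        refine Finset.sum_le_sum fun x _ => (measure_biUnion_finset_le _ _).trans ?_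
        simp only [cylinder, μ, infinitePi_uniformOfFintype_cylinder, Finset.sum_const,
          nsmul_eq_mul, Finset.card_insert_of_notMem hj]
        gcongr
        exact hK _
    _ = (K : ℝ≥0∞) / Fintype.card α := by
        rw [Finset.sum_const, Finset.card_univ, Fintype.card_fun, Fintype.card_coe, nsmul_eq_mul,
          Nat.cast_pow, pow_succ, mul_left_comm, ← mul_assoc (_ ^ _), ← mul_pow,
          ENNReal.mul_inv_cancel hcard (by finiteness), one_pow, one_mul, div_eq_mul_inv]

end infinitePi

/-! ### Fingerprints -/

/-- The fingerprints of the windows `f x, …, f (x + 2 ^ j - 1)`: a window is hashed, with the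
multiplier `r j` of its level, together from the fingerprints of its two halves, which are read as
the digits of a number in base `U`. -/
def fingerprint (W U D : ℕ) (r f : ℕ → ℕ) : ℕ → ℕ → ℕ
  | 0, x => f x + 1
  | j + 1, x => 1 + mulHash W D (r j)
      (fingerprint W U D r f j x * U + fingerprint W U D r f j (x + 2 ^ j))

/-- The fingerprints of the two halves of the window of length `2 ^ (j + 1)` at `x`, as one number
in base `U`. -/
def halvesCode (W U D : ℕ) (r f : ℕ → ℕ) (j x : ℕ) : ℕ :=
  fingerprint W U D r f j x * U + fingerprint W U D r f j (x + 2 ^ j)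

/-- Two windows of length `2 ^ (j + 1)` differ in the fingerprint of a half but get the same
fingerprint. -/
def Collide (W U D : ℕ) (r f g : ℕ → ℕ) (j x y : ℕ) : Prop :=
  halvesCode W U D r f j x ≠ halvesCode W U D r g j y ∧
    fingerprint W U D r f (j + 1) x = fingerprint W U D r g (j + 1) y

theorem mul_add_inj_of_lt {U a b a' b' : ℕ} (hb : b < U) (hb' : b' < U)
    (h : a * U + b = a' * U + b') : a = a' ∧ b = b' := by
  have hmod := congrArg (· % U) h
  have hdiv := congrArg (· / U) h
  simp only [Nat.mul_add_mod_self_right, Nat.mod_eq_of_lt hb, Nat.mod_eq_of_lt hb'] at hmod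
  simp only [mul_comm _ U, Nat.mul_add_div (Nat.zero_lt_of_lt hb), Nat.div_eq_of_lt hb,
    Nat.div_eq_of_lt hb', add_zero] at hdiv
  exact ⟨hdiv, hmod⟩

theorem mul_add_lt_mul {U V a b : ℕ} (ha : a < V) (hb : b < U) : a * U + b < V * U :=
  calc a * U + b < (a + 1) * U := by rw [add_one_mul]; omega
    _ ≤ V * U := Nat.mul_le_mul_right U ha

section fingerprint

variable {W U D : ℕ} {r r' f g : ℕ → ℕ}

theorem fingerprint_congr {j x y : ℕ} (h : ∀ t < 2 ^ j, f (x + t) = g (y + t)) :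
    fingerprint W U D r f j x = fingerprint W U D r g j y := by
  induction j generalizing x y with
  | zero => simpa only [fingerprint, add_zero, Nat.add_right_cancel_iff] using h 0 Nat.one_pos
  | succ j ih =>
    rw [pow_succ] at h
    simp only [fingerprint]
    rw [ih fun t ht => h t (by omega), ih (x := x + 2 ^ j) (y := y + 2 ^ j) fun t ht => by
      rw [add_assoc, add_assoc]; exact h _ (by omega)]

theorem fingerprint_congr_multipliers {j : ℕ} (h : ∀ i < j, r i = r' i) (x : ℕ) :
    fingerprint W U D r f j x = fingerprint W U D r' f j x := by
  induction j generalizing x with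
  | zero => rfl
  | succ j ih => simp only [fingerprint, ih fun i hi => h i (by omega), h j (by omega)]

theorem fingerprint_pos (j x : ℕ) : 0 < fingerprint W U D r f j x := by
  cases j <;> simp [fingerprint]

theorem fingerprint_add_two_le (hW : 0 < W) (hD : (W - 1) / D + 3 ≤ U) (hf : ∀ x, f x + 3 ≤ U)
    (j x : ℕ) : fingerprint W U D r f j x + 2 ≤ U := by
  cases j with
  | zero => have := hf x; simp only [fingerprint]; omega
  | succ j => have := mulHash_le hW D (r j); simp only [fingerprint]; grind

theorem eq_of_fingerprint_eq {n j J x y : ℕ} (hf : ∀ i z, fingerprint W U D r f i z < U)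
    (hg : ∀ i z, fingerprint W U D r g i z < U)
    (hc : ∀ i < J, ∀ x < n, ∀ y < n, ¬ Collide W U D r f g i x y) (hj : j ≤ J)
    (hx : x + 2 ^ j ≤ n) (hy : y + 2 ^ j ≤ n)
    (h : fingerprint W U D r f j x = fingerprint W U D r g j y) :
    ∀ t < 2 ^ j, f (x + t) = g (y + t) := by
  induction j generalizing x y with
  | zero => simpa [fingerprint] using h
  | succ j ih =>
    have hpos : 0 < 2 ^ j := by positivity
    rw [pow_succ] at hx hy ⊢
    have hcode : halvesCode W U D r f j x = halvesCode W U D r g j y :=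
      not_not.1 fun hne => hc j (by omega) x (by omega) y (by omega) ⟨hne, h⟩
    obtain ⟨hleft, hright⟩ := mul_add_inj_of_lt (hf _ _) (hg _ _) hcode
    intro t ht
    obtain htj | ⟨t, rfl⟩ := (lt_or_ge t (2 ^ j)).imp_right Nat.exists_eq_add_of_le
    · exact ih (by omega) (by omega) (by omega) hleft t htj
    · simpa only [add_assoc] using ih (by omega) (by omega) (by omega) hright t (by omega)

end fingerprint

/-- The words on a tape, as multipliers. -/
def tapeWords {w : ℕ} (ω : Tape w) : ℕ → ℕ := fun i => ω i

section collision

variable {w U D : ℕ} {f g : ℕ → ℕ}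
  (hf : ∀ (ω : Tape w) i z, fingerprint (2 ^ w) U D (tapeWords ω) f i z < U)
  (hg : ∀ (ω : Tape w) i z, fingerprint (2 ^ w) U D (tapeWords ω) g i z < U)

include hf hg

theorem tapeLaw_collide_le (hD : 0 < D) (j x y : ℕ) :
    tapeLaw w {ω | Collide (2 ^ w) U D (tapeWords ω) f g j x y} ≤
      ((4 * D + 2 * (U * U) : ℕ) : ℝ≥0∞) / (2 ^ w : ℕ) := by
  classical
  let code (f : ℕ → ℕ) (x : ℕ) (ω : Tape w) := halvesCode (2 ^ w) U D (tapeWords ω) f j x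
  let bad (ω : Tape w) : Finset (Fin (2 ^ w)) :=
    if code f x ω = code g y ω then ∅ else Finset.univ.filter fun r : Fin (2 ^ w) =>
      mulHash (2 ^ w) D r (code f x ω) = mulHash (2 ^ w) D r (code g y ω)
  have hcode (f x) : DependsOn (code f x) (Finset.range j) := fun ω ω' h => by
    have h' : ∀ i < j, tapeWords ω i = tapeWords ω' i := fun i hi =>
      congrArg Fin.val (h i (by simpa using hi))
    simp only [code, halvesCode, fingerprint_congr_multipliers h']
  have hbad : DependsOn bad (Finset.range j) := fun ω ω' h => by
    simp only [bad, hcode f x h, hcode g y h]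
  have hcard (ω) : (bad ω).card ≤ 4 * D + 2 * (U * U) := by
    by_cases h : code f x ω = code g y ω
    · simp [bad, h]
    · simp only [bad, if_neg h]
      exact card_mulHash_eq_le hD (mul_add_lt_mul (hf ..) (hf ..))
        (mul_add_lt_mul (hg ..) (hg ..)) h
  have hsub : {ω | Collide (2 ^ w) U D (tapeWords ω) f g j x y} ⊆
      {ω : Tape w | ω j ∈ bad ω} := by
    rintro ω ⟨hne, heq⟩
    have hbad_eq : bad ω = _ := if_neg (show code f x ω ≠ code g y ω from hne)
    change ω j ∈ bad ω
    rw [hbad_eq]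
    exact Finset.mem_filter.2 ⟨Finset.mem_univ _, Nat.add_left_cancel heq⟩
  refine (measure_mono hsub).trans ?_
  simpa only [tapeLaw, Fintype.card_fin] using
    infinitePi_uniformOfFintype_mem_le Finset.notMem_range_self hbad hcard

theorem tapeLaw_exists_collide_le (hD : 0 < D) (J n : ℕ) :
    tapeLaw w {ω | ∃ i < J, ∃ x < n, ∃ y < n, Collide (2 ^ w) U D (tapeWords ω) f g i x y} ≤
      ((J * n * n * (4 * D + 2 * (U * U)) : ℕ) : ℝ≥0∞) / (2 ^ w : ℕ) := by
  have hsub : {ω : Tape w | ∃ i < J, ∃ x < n, ∃ y < n,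
        Collide (2 ^ w) U D (tapeWords ω) f g i x y} ⊆
      ⋃ p ∈ Finset.range J ×ˢ Finset.range n ×ˢ Finset.range n,
        {ω | Collide (2 ^ w) U D (tapeWords ω) f g p.1 p.2.1 p.2.2} := by
    rintro ω ⟨i, hi, x, hx, y, hy, h⟩
    simp only [Set.mem_iUnion]
    exact ⟨(i, x, y), by simp [hi, hx, hy], h⟩
  refine (measure_mono hsub).trans ((measure_biUnion_finset_le _ _).trans
    ((Finset.sum_le_sum fun p _ => tapeLaw_collide_le hf hg hD _ _ _).trans_eq ?_))
  simp only [Finset.sum_const, Finset.card_product, Finset.card_range, nsmul_eq_mul,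
    ← mul_div_assoc, ← Nat.cast_mul, ← mul_assoc J]

end collision

/-! ### Edit scripts between prefixes -/

namespace EditScript

variable {α : Type*} {x y x' y' : List α} {d d' : ℕ}

theorem refl (x : List α) : EditScript x x 0 := by
  induction x with
  | nil => exact .nil
  | cons a x ih => exact ih.keep a

theorem append (h : EditScript x y d) (h' : EditScript x' y' d') :
    EditScript (x ++ x') (y ++ y') (d + d') := by
  induction h with
  | nil => simpa using h'
  | keep a _ ih => exact ih.keep a
  | subst a b _ ih => rw [add_right_comm]; exact ih.subst a b
  | delete a _ ih => rw [add_right_comm]; exact ih.delete a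
  | insert b _ ih => rw [add_right_comm]; exact ih.insert b

theorem delete_all (x : List α) : EditScript x [] x.length := by
  induction x with
  | nil => exact .nil
  | cons a x ih => exact ih.delete a

theorem insert_all (y : List α) : EditScript [] y y.length := by
  induction y with
  | nil => exact .nil
  | cons b y ih => exact ih.insert b

theorem length_le (h : EditScript x y d) : x.length ≤ y.length + d := by
  induction h <;> simp_all <;> omega

theorem exists_take_right (h : EditScript x y d) (m : ℕ) :
    ∃ d' ≤ d + (y.length - m), EditScript x (y.take m) d' := by
  have take_zero {x y : List α} {d : ℕ} (h : EditScript x y d) :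
      ∃ d' ≤ d + (y.length - 0), EditScript x (y.take 0) d' :=
    ⟨_, by have := h.length_le; omega, delete_all x⟩
  induction h generalizing m with
  | nil => exact ⟨0, by simp, by simpa using nil⟩
  | keep a h ih =>
    cases m with
    | zero => exact take_zero (h.keep a)
    | succ m =>
      obtain ⟨d', hd', h'⟩ := ih m
      exact ⟨d', by simpa using hd', h'.keep a⟩
  | subst a b h ih =>
    cases m with
    | zero => exact take_zero (h.subst a b)
    | succ m =>
      obtain ⟨d', hd', h'⟩ := ih m
      exact ⟨d' + 1, by rw [List.length_cons]; omega, h'.subst a b⟩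
  | delete a _ ih =>
    obtain ⟨d', hd', h'⟩ := ih m
    exact ⟨d' + 1, by omega, h'.delete a⟩
  | insert b h ih =>
    cases m with
    | zero => exact take_zero (h.insert b)
    | succ m =>
      obtain ⟨d', hd', h'⟩ := ih m
      exact ⟨d' + 1, by rw [List.length_cons]; omega, h'.insert b⟩

/-- The lists `x₁` and `y₁` hold the at most one character that the first edit takes from each
side. -/
theorem eq_or_exists_edit (h : EditScript x y d) :
    x = y ∨ ∃ u x₁ y₁ x' y' e, d = e + 1 ∧ x = u ++ (x₁ ++ x') ∧ y = u ++ (y₁ ++ y') ∧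
      x₁.length ≤ 1 ∧ y₁.length ≤ 1 ∧ EditScript x' y' e := by
  induction h with
  | nil => exact .inl rfl
  | keep a h ih =>
    obtain rfl | ⟨u, x₁, y₁, x', y', e, hd, rfl, rfl, hx₁, hy₁, h'⟩ := ih
    · exact .inl rfl
    · exact .inr ⟨a :: u, x₁, y₁, x', y', e, hd, rfl, rfl, hx₁, hy₁, h'⟩
  | subst a b h _ => exact .inr ⟨[], [a], [b], _, _, _, rfl, rfl, rfl, le_rfl, le_rfl, h⟩
  | delete a h _ => exact .inr ⟨[], [a], [], _, _, _, rfl, rfl, rfl, le_rfl, Nat.zero_le _, h⟩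
  | insert b h _ => exact .inr ⟨[], [], [b], _, _, _, rfl, rfl, rfl, Nat.zero_le _, le_rfl, h⟩

end EditScript

section editDist

variable {α : Type*} {n m : ℕ} (A : Fin n → α) (B : Fin m → α)

theorem editScript_editDist : EditScript (List.ofFn A) (List.ofFn B) (editDist A B) :=
  Nat.sInf_mem (EditScript.exists_script _ _)

variable {A B}

theorem editDist_le {d : ℕ} (h : EditScript (List.ofFn A) (List.ofFn B) d) : editDist A B ≤ d :=
  Nat.sInf_le h

end editDist

/-- The prefixes of lengths `x` and `y` of `a` and `b` have edit distance at most `c`. -/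
def PrefixED {α : Type*} (a b : List α) (x y c : ℕ) : Prop :=
  ∃ d ≤ c, EditScript (a.take x) (b.take y) d

/-- The windows of length `r` at `x` in `a` and at `y` in `b` are equal. -/
def MatchAt {α : Type*} (a b : List α) (x y r : ℕ) : Prop :=
  ∀ t < r, a[x + t]? = b[y + t]?

theorem MatchAt.take_drop_eq {α : Type*} {a b : List α} {x y r : ℕ} (h : MatchAt a b x y r) :
    (a.drop x).take r = (b.drop y).take r := by
  refine List.ext_getElem? fun t => ?_
  simp only [List.getElem?_take, List.getElem?_drop]
  exact if_ctx_congr Iff.rfl (h t) fun _ => rfl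

theorem MatchAt.mono {α : Type*} {a b : List α} {x y r r' : ℕ} (h : MatchAt a b x y r)
    (hr : r' ≤ r) : MatchAt a b x y r' :=
  fun t ht => h t (ht.trans_le hr)

theorem MatchAt.tail {α : Type*} {a b : List α} {x y r s : ℕ} (h : MatchAt a b x y (s + r)) :
    MatchAt a b (x + s) (y + s) r :=
  fun t ht => by simpa only [add_assoc] using h (s + t) (by omega)

namespace PrefixED

variable {α : Type*} {a b : List α} {x y y' c c' r : ℕ}

theorem zero_left (hy : y ≤ c) : PrefixED a b 0 y c :=
  ⟨_, (List.length_take_le y b).trans hy, EditScript.insert_all _⟩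

theorem mono (h : PrefixED a b x y c) (hc : c ≤ c') : PrefixED a b x y c' :=
  h.imp fun _ h => ⟨h.1.trans hc, h.2⟩

theorem extend_right (h : PrefixED a b x y c) (hy : y ≤ y') :
    PrefixED a b x y' (c + (y' - y)) := by
  obtain ⟨d, hd, h⟩ := h
  have hins := h.append (EditScript.insert_all ((b.drop y).take (y' - y)))
  rw [List.append_nil, ← List.take_add, Nat.add_sub_cancel' hy] at hins
  exact ⟨_, add_le_add hd (List.length_take_le ..), hins⟩

theorem shrink_right (h : PrefixED a b x y c) (hy : y' ≤ y) :
    PrefixED a b x y' (c + (y - y')) := by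
  obtain ⟨d, hd, h⟩ := h
  obtain ⟨d', hd', h'⟩ := h.exists_take_right y'
  rw [List.take_take, min_eq_left hy] at h'
  have := List.length_take_le y b
  exact ⟨d', by omega, h'⟩

theorem move_right (h : PrefixED a b x y c) (hy : c + (y' - y) + (y - y') ≤ c') :
    PrefixED a b x y' c' := by
  obtain hle | hle := le_total y y'
  · exact (h.extend_right hle).mono (by omega)
  · exact (h.shrink_right hle).mono (by omega)

theorem succ_left (h : PrefixED a b x y c) : PrefixED a b (x + 1) y (c + 1) := by
  obtain ⟨d, hd, h⟩ := h
  have hdel := h.append (EditScript.delete_all ((a.drop x).take 1))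
  rw [List.append_nil, ← List.take_add] at hdel
  exact ⟨_, add_le_add hd (List.length_take_le ..), hdel⟩

theorem append_match (h : PrefixED a b x y c) (hm : MatchAt a b x y r) :
    PrefixED a b (x + r) (y + r) c := by
  obtain ⟨d, hd, h⟩ := h
  have hkeep := h.append (EditScript.refl ((a.drop x).take r))
  rw [← List.take_add, hm.take_drop_eq, ← List.take_add] at hkeep
  exact ⟨d, hd, hkeep⟩

end PrefixED

/-! ### Furthest reaching positions on blocks of diagonals -/

/-- Positions `p` and `q` in two strings lie on the block `β` of diagonals, which consists of the
`l` diagonals `q - p = β * l - K, …, β * l - K + l - 1`. -/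
def OnBlock (K l β p q : ℕ) : Prop := p + β * l ≤ q + K ∧ q + K < p + β * l + l

/-- A coarse version of `OnBlock` that depends on the positions only through the grid cells of
width `l` that they lie in. -/
def NearBlock (K l β x y : ℕ) : Prop :=
  (y + K) / l = x / l + β ∨ (y + K) / l = x / l + β + 1

section Block

variable {K k l nb β β' p q p' q' x y : ℕ}

theorem exists_onBlock (hl : 0 < l) (h : p ≤ q + K) : ∃ β, OnBlock K l β p q := by
  obtain ⟨v, hv⟩ := Nat.exists_eq_add_of_le h
  have := Nat.div_mul_le_self v l
  have := Nat.lt_div_mul_add (a := v) hl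
  exact ⟨v / l, by omega, by omega⟩

theorem OnBlock.one_le (h : OnBlock (k + l) l β p q) (hpq : p ≤ q + k) : 1 ≤ β := by
  by_contra hβ
  obtain rfl : β = 0 := by omega
  have := h.2
  omega

theorem OnBlock.le (h : OnBlock (k + l) l β p q) (hqp : q ≤ p + k)
    (hnb : 2 * k + l < (nb + 1) * l) : β ≤ nb := by
  by_contra hβ
  have := Nat.mul_le_mul_right l (show nb + 1 ≤ β by omega)
  have := h.1
  omega

theorem OnBlock.le_add_one (h : OnBlock K l β p q) (h' : OnBlock K l β' p' q')
    (hd : q + p' ≤ q' + p + l) : β ≤ β' + 1 := by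
  by_contra hβ
  have := Nat.mul_le_mul_right l (show β' + 2 ≤ β by omega)
  rw [add_mul] at this
  have := h.1
  have := h'.2
  omega

theorem OnBlock.add_right (h : OnBlock K l β p q) (s : ℕ) : OnBlock K l β (p + s) (q + s) :=
  ⟨by have := h.1; omega, by have := h.2; omega⟩

theorem OnBlock.nearBlock (hl : 0 < l) (h : OnBlock K l β p q) : NearBlock K l β p q := by
  obtain ⟨h₁, h₂⟩ := h
  have := Nat.div_add_mod p l
  have := Nat.mod_lt p hl
  have hle : p / l + β ≤ (q + K) / l := by
    rw [Nat.le_div_iff_mul_le hl, add_mul, mul_comm (p / l)]; omega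
  have hlt : (q + K) / l < p / l + β + 2 := by
    rw [Nat.div_lt_iff_lt_mul hl, add_mul, add_mul, mul_comm (p / l)]; omega
  unfold NearBlock; omega

theorem NearBlock.le_add (hl : 0 < l) (h : NearBlock K l β x y) :
    x + β * l ≤ y + K + l ∧ y + K ≤ x + β * l + 2 * l := by
  have hy := Nat.div_add_mod (y + K) l
  have := Nat.div_add_mod x l
  have := Nat.mod_lt (y + K) hl
  have := Nat.mod_lt x hl
  obtain h | h := h <;> rw [h] at hy <;> simp only [mul_add, mul_one, mul_comm l β] at hy <;> omega

end Block

theorem matchAt_of_drop_eq_append {α : Type*} {a b u v v' : List α} {p q : ℕ}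
    (ha : a.drop p = u ++ v) (hb : b.drop q = u ++ v') : MatchAt a b p q u.length := fun t ht => by
  rw [← List.getElem?_drop, ← List.getElem?_drop, ha, hb, List.getElem?_append_left ht,
    List.getElem?_append_left ht]

open scoped Classical in
/-- The largest power `2 ^ j` with `j < L` and `hit j`, or `0`. -/
noncomputable def jump (hit : ℕ → Prop) (L : ℕ) : ℕ :=
  ((Finset.range L).filter hit).sup (2 ^ ·)

section jump

variable {hit : ℕ → Prop} {L j : ℕ}

theorem le_jump (hj : j < L) (h : hit j) : 2 ^ j ≤ jump hit L := by
  classical exact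
    Finset.le_sup (f := (2 ^ ·)) (Finset.mem_filter.2 ⟨Finset.mem_range.2 hj, h⟩)

theorem jump_eq_zero_or (hit : ℕ → Prop) (L : ℕ) :
    jump hit L = 0 ∨ ∃ j, hit j ∧ jump hit L = 2 ^ j := by
  classical
  obtain hempty | hne := ((Finset.range L).filter hit).eq_empty_or_nonempty
  · exact .inl (by rw [jump, hempty, Finset.sup_empty]; rfl)
  · obtain ⟨j, hj, hsup⟩ := Finset.exists_mem_eq_sup _ hne (2 ^ · : ℕ → ℕ)
    exact .inr ⟨j, (Finset.mem_filter.1 hj).2, hsup⟩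

theorem jump_succ_of_hit (h : hit L) : jump hit (L + 1) = max (jump hit L) (2 ^ L) := by
  rw [jump, Finset.range_add_one, Finset.filter_insert, if_pos h, Finset.sup_insert, max_comm]
  rfl

theorem jump_succ_of_not_hit (h : ¬ hit L) : jump hit (L + 1) = jump hit L := by
  rw [jump, Finset.range_add_one, Finset.filter_insert, if_neg h, jump]

end jump

/-- The best position on a block and its two neighbours. -/
def bestNeighbor (F : ℕ → ℕ) (b : ℕ) : ℕ := max (max (F (b - 1)) (F b)) (F (b + 1))

theorem exists_bestNeighbor_eq (F : ℕ → ℕ) (b : ℕ) :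
    ∃ b', bestNeighbor F b = F b' ∧ b' ≤ b + 1 ∧ b ≤ b' + 1 := by
  unfold bestNeighbor
  obtain h | h := max_choice (max (F (b - 1)) (F b)) (F (b + 1))
  · obtain h' | h' := max_choice (F (b - 1)) (F b)
    · exact ⟨b - 1, by rw [h, h'], by omega, by omega⟩
    · exact ⟨b, by rw [h, h'], by omega, by omega⟩
  · exact ⟨b + 1, h, le_rfl, by omega⟩

theorem le_bestNeighbor (F : ℕ → ℕ) {b b' : ℕ} (h : b' ≤ b + 1) (h' : b ≤ b' + 1) :
    F b' ≤ bestNeighbor F b := by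
  obtain rfl | rfl | rfl : b' = b - 1 ∨ b' = b ∨ b' = b + 1 := by omega
  all_goals simp [bestNeighbor]

/-- `front hit nb L i b` is the position in the first string that is reached after `i` rounds on
block `b` of diagonals: in each round, starting from the best position on neighbouring blocks, the
longest window that is known to match is skipped, and one more character. The proposition
`hit j m b` is that the window of length `2 ^ j` at `m` is known to match on block `b`, and
`1, …, nb` are the blocks in use. -/
noncomputable def front (hit : ℕ → ℕ → ℕ → Prop) (nb L : ℕ) : ℕ → ℕ → ℕ
  | 0, _ => 0
  | i + 1, b =>
    if 1 ≤ b ∧ b ≤ nb then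
      bestNeighbor (front hit nb L i) b +
        jump (hit · (bestNeighbor (front hit nb L i) b) b) L + 1
    else 0

section Front

variable {hit : ℕ → ℕ → ℕ → Prop} {nb L : ℕ}

theorem front_succ {i b : ℕ} (hb : 1 ≤ b) (hb' : b ≤ nb) : front hit nb L (i + 1) b =
    bestNeighbor (front hit nb L i) b +
      jump (hit · (bestNeighbor (front hit nb L i) b) b) L + 1 :=
  if_pos ⟨hb, hb'⟩

theorem front_of_not {i b : ℕ} (h : ¬ (1 ≤ b ∧ b ≤ nb)) : front hit nb L i b = 0 := by
  cases i
  · rfl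
  · exact if_neg h

theorem front_le {n : ℕ} (hh : ∀ j m b, hit j m b → m + 2 ^ j ≤ n) (i b : ℕ) :
    front hit nb L i b ≤ n + i := by
  induction i generalizing b with
  | zero => exact Nat.zero_le _
  | succ i ih =>
    by_cases hb : 1 ≤ b ∧ b ≤ nb
    · rw [front_succ hb.1 hb.2]
      obtain ⟨b', hm, -⟩ := exists_bestNeighbor_eq (front hit nb L i) b
      obtain h | ⟨j, hj, h⟩ := jump_eq_zero_or (hit · (bestNeighbor (front hit nb L i) b) b) L
      · have := ih b'; omega
      · have := hh _ _ _ hj; omega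
    · rw [front_of_not hb]; exact Nat.zero_le _

theorem lt_front_succ {i β β' : ℕ} (h : β ≤ β' + 1) (h' : β' ≤ β + 1) (hb : 1 ≤ β')
    (hb' : β' ≤ nb) : front hit nb L i β < front hit nb L (i + 1) β' := by
  rw [front_succ hb hb']
  have := le_bestNeighbor (front hit nb L i) h h'
  omega

theorem front_le_front_add {β : ℕ} (hb : 1 ≤ β) (hb' : β ≤ nb) (i t : ℕ) :
    front hit nb L i β ≤ front hit nb L (i + t) β := by
  induction t with
  | zero => rfl
  | succ t ih => exact ih.trans (lt_front_succ (i := i + t) (by omega) (by omega) hb hb').le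

section Sound

variable {α : Type*} {a b : List α} {K k l : ℕ}

/-- Every known match is a common window, on a diagonal that is not far from its block. -/
def HitSound (a b : List α) (K l : ℕ) (hit : ℕ → ℕ → ℕ → Prop) : Prop :=
  ∀ j m β, hit j m β → ∃ y, NearBlock K l β m y ∧ MatchAt a b m y (2 ^ j)

theorem PrefixED.add_hit {j m β c : ℕ} (hl : 0 < l) (hh : HitSound a b K l hit)
    (hj : hit j m β) (h : PrefixED a b m (m + β * l - K) c) :
    PrefixED a b (m + 2 ^ j) (m + 2 ^ j + β * l - K) (c + 4 * l) := by
  obtain ⟨y, hy, hmatch⟩ := hh _ _ _ hj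
  have := hy.le_add hl
  have hmove : PrefixED a b m y (c + 2 * l) := h.move_right (by omega)
  exact (hmove.append_match hmatch).move_right (by omega)

theorem PrefixED.add_jump {m β c : ℕ} (hl : 0 < l) (hh : HitSound a b K l hit)
    (h : PrefixED a b m (m + β * l - K) c) :
    PrefixED a b (m + jump (hit · m β) L) (m + jump (hit · m β) L + β * l - K) (c + 4 * l) := by
  obtain hjump | ⟨j, hj, hjump⟩ := jump_eq_zero_or (hit · m β) L
  · rw [hjump]
    exact h.mono (by omega)
  · rw [hjump]
    exact h.add_hit hl hh hj

theorem prefixED_front (hl : 0 < l) (hnb : nb * l ≤ K + k) (hh : HitSound a b K l hit)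
    (i : ℕ) {β : ℕ} (hβ : β * l ≤ K + k + l) :
    PrefixED a b (front hit nb L i β) (front hit nb L i β + β * l - K)
      (k + l + 8 * l * i) := by
  induction i generalizing β with
  | zero => exact .zero_left (by simp only [front]; omega)
  | succ i ih =>
    by_cases hb : 1 ≤ β ∧ β ≤ nb
    swap
    · rw [front_of_not hb]
      exact .zero_left (by have := Nat.zero_le (8 * l * (i + 1)); omega)
    obtain ⟨β', hmax, hβ', hβ''⟩ := exists_bestNeighbor_eq (front hit nb L i) β
    have hle := Nat.mul_le_mul_right l hb.2
    have hle' := Nat.mul_le_mul_right l hβ'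
    have hle'' := Nat.mul_le_mul_right l hβ''
    rw [Nat.succ_mul] at hle' hle''
    have hstart : PrefixED a b (front hit nb L i β') (front hit nb L i β' + β * l - K)
        (k + l + 8 * l * i + l) := (ih (by omega)).move_right (by omega)
    rw [front_succ hb.1 hb.2, hmax]
    refine (hstart.add_jump hl hh).succ_left.move_right ?_
    rw [mul_add]
    omega

end Sound

section Complete

variable {α : Type*} {a b : List α}

/-- Every common window that is not far from a block of diagonals is a known match. -/
def HitComplete (a b : List α) (K l L : ℕ) (hit : ℕ → ℕ → ℕ → Prop) : Prop :=
  ∀ j m y β, j < L → m + 2 ^ j ≤ a.length → y + 2 ^ j ≤ b.length → MatchAt a b m y (2 ^ j) →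
    NearBlock K l β m y → hit j m β

variable {K k l p q r i β : ℕ}

/-- The largest power of two in a number exceeds its half. -/
theorem le_front_succ_add_div_two (hl : 0 < l) (hL : a.length < 2 ^ L)
    (hC : HitComplete a b K l L hit) (hβ : 1 ≤ β) (hβ' : β ≤ nb)
    (hp : p + r ≤ a.length) (hq : q + r ≤ b.length) (hm : MatchAt a b p q r)
    (hpq : OnBlock K l β p q) (hf : p ≤ front hit nb L i β) {R : ℕ}
    (hR : p + r ≤ front hit nb L i β + R) :
    p + r ≤ front hit nb L (i + 1) β + R / 2 := by
  have hle := le_bestNeighbor (front hit nb L i) (b := β) (b' := β) (by omega) (by omega)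
  rw [front_succ hβ hβ']
  generalize bestNeighbor (front hit nb L i) β = m at *
  by_cases hlt : m < p + r
  swap
  · omega
  obtain ⟨s, rfl⟩ := Nat.exists_eq_add_of_le (hf.trans hle)
  obtain ⟨ρ, rfl⟩ := Nat.exists_eq_add_of_le (Nat.le_of_add_le_add_left hlt.le)
  have hρ : ρ ≠ 0 := by omega
  have hlog := Nat.pow_log_le_self 2 hρ
  have hlog' := Nat.lt_pow_succ_log_self one_lt_two ρ
  rw [pow_succ] at hlog'
  have hlogL : Nat.log 2 ρ < L := Nat.log_lt_of_lt_pow hρ (by omega)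
  have hjump := le_jump (hit := (hit · (p + s) β)) hlogL <| hC _ _ (q + s) _ hlogL (by omega)
    (by omega) (hm.tail.mono hlog) ((hpq.add_right s).nearBlock hl)
  omega

theorem le_front_add_div_two_pow (hl : 0 < l) (hL : a.length < 2 ^ L)
    (hC : HitComplete a b K l L hit) (hβ : 1 ≤ β) (hβ' : β ≤ nb)
    (hp : p + r ≤ a.length) (hq : q + r ≤ b.length) (hm : MatchAt a b p q r)
    (hpq : OnBlock K l β p q) (hf : p ≤ front hit nb L i β) (t : ℕ) :
    p + r ≤ front hit nb L (i + t) β + r / 2 ^ t := by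
  induction t with
  | zero => simpa using hf
  | succ t ih =>
    rw [← add_assoc, pow_succ, ← Nat.div_div_eq_div_mul]
    exact le_front_succ_add_div_two hl hL hC hβ hβ' hp hq hm hpq
      (hf.trans (front_le_front_add hβ hβ' i t)) ih

theorem add_length_le_front_add (hl : 0 < l) (hL : a.length < 2 ^ L)
    (hC : HitComplete a b K l L hit) (hβ : 1 ≤ β) (hβ' : β ≤ nb) {u v v' : List α}
    (ha : a.drop p = u ++ v) (hb : b.drop q = u ++ v') (hp : p ≤ a.length) (hq : q ≤ b.length)
    (hpq : OnBlock K l β p q) (hf : p ≤ front hit nb L i β) :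
    p + u.length ≤ front hit nb L (i + L) β := by
  have hla := congrArg List.length ha
  have hlb := congrArg List.length hb
  rw [List.length_drop, List.length_append] at hla hlb
  have := le_front_add_div_two_pow hl hL hC hβ hβ' (by omega) (by omega)
    (matchAt_of_drop_eq_append ha hb) hpq hf L
  rwa [Nat.div_eq_of_lt (by omega)] at this

/-- Between two edits, the common window is passed within `L` rounds, and one more round passes the
edit. -/
theorem exists_length_le_front (hl : 0 < l) (hnb : 2 * k + l < (nb + 1) * l)
    (hL : a.length < 2 ^ L) (hC : HitComplete a b (k + l) l L hit) {d : ℕ}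
    (hs : EditScript (a.drop p) (b.drop q) d) (hp : p ≤ a.length) (hq : q ≤ b.length)
    (hpq : p + d ≤ q + k) (hqp : q + d ≤ p + k) (hβ : OnBlock (k + l) l β p q)
    (hf : p ≤ front hit nb L i β) :
    ∃ β', 1 ≤ β' ∧ β' ≤ nb ∧ a.length ≤ front hit nb L (i + d * (L + 1) + L) β' := by
  induction d using Nat.strong_induction_on generalizing p q i β with
  | _ d ih =>
  have hβ1 : 1 ≤ β := hβ.one_le (by omega)
  have hβnb : β ≤ nb := hβ.le (by omega) hnb
  obtain heq | ⟨u, x₁, y₁, x, y, e, rfl, hx, hy, hx₁, hy₁, hs'⟩ := hs.eq_or_exists_edit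
  · have hend := add_length_le_front_add hl hL hC hβ1 hβnb (List.append_nil _).symm
      (heq.symm.trans (List.append_nil _).symm) hp hq hβ hf
    have hmono := front_le_front_add (hit := hit) (L := L) hβ1 hβnb (i + L) (d * (L + 1))
    rw [List.length_drop] at hend
    rw [add_right_comm i L] at hmono
    exact ⟨β, hβ1, hβnb, by omega⟩
  · have hpass := add_length_le_front_add hl hL hC hβ1 hβnb hx hy hp hq hβ hf
    have hlx := congrArg List.length hx
    have hly := congrArg List.length hy
    simp only [List.length_drop, List.length_append] at hlx hly
    have hdx : a.drop (p + (u.length + x₁.length)) = x := by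
      rw [← List.drop_drop, hx, ← List.append_assoc, ← List.length_append, List.drop_left]
    have hdy : b.drop (q + (u.length + y₁.length)) = y := by
      rw [← List.drop_drop, hy, ← List.append_assoc, ← List.length_append, List.drop_left]
    obtain ⟨β', hβ'⟩ := exists_onBlock hl
      (show p + (u.length + x₁.length) ≤ q + (u.length + y₁.length) + (k + l) by omega)
    have hnext := lt_front_succ (hit := hit) (L := L) (i := i + L)
      (hβ.le_add_one hβ' (by omega)) (hβ'.le_add_one hβ (by omega)) (hβ'.one_le (by omega))
      (hβ'.le (by omega) hnb)
    obtain ⟨β'', h1, hle, hreach⟩ := ih e (by omega) (i := i + L + 1) (by rwa [hdx, hdy])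
      (by omega) (by omega) (by omega) (by omega) hβ' (by omega)
    refine ⟨β'', h1, hle, ?_⟩
    rwa [show i + (e + 1) * (L + 1) + L = i + L + 1 + e * (L + 1) + L by ring]

end Complete

end Front

/-! ### Tables of fingerprints -/

/-- The address of an entry of a table; `j`, `x`, `c` are its digits in base `U`. -/
def cell (U j x c : ℕ) : ℕ := (j * U + x) * U + c

theorem cell_inj {U j x c j' x' c' : ℕ} (hx : x < U) (hc : c < U) (hx' : x' < U) (hc' : c' < U)
    (e : cell U j x c = cell U j' x' c') : j = j' ∧ x = x' ∧ c = c' := by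
  obtain ⟨hjx, rfl⟩ := mul_add_inj_of_lt hc hc' e
  obtain ⟨rfl, rfl⟩ := mul_add_inj_of_lt hx hx' hjx
  exact ⟨rfl, rfl, rfl⟩

theorem le_cell {U j x c : ℕ} (h : 1 ≤ x ∨ U ≤ c + 1) : U ≤ cell U j x c + 1 := by
  rw [cell]
  rcases h with hx | hc
  · have : 1 * U ≤ (j * U + x) * U := Nat.mul_le_mul_right _ (by omega)
    omega
  · omega

open Classical in
/-- The array `D` holds the fingerprints `H j x` of the windows in `S`, and for each of them a mark
that can be looked up from the level `j`, the block `(x + K) / l` of the position `x`, and the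
fingerprint.  The digit `U - 1`, which is no fingerprint, addresses the former. -/
structure IsTable (U K l : ℕ) (H : ℕ → ℕ → ℕ) (S : ℕ → ℕ → Prop) (D : ℕ → ℕ) : Prop where
  entry : ∀ j x, x < U → D (cell U j x (U - 1)) = if S j x then H j x else 0
  mark : ∀ j β c, 1 ≤ β → β < U → c < U - 1 →
    D (cell U j β c) = if ∃ y, S j y ∧ (y + K) / l = β ∧ H j y = c then 1 else 0

namespace IsTable

variable {U K l : ℕ} {H : ℕ → ℕ → ℕ} {S S' : ℕ → ℕ → Prop} {D : ℕ → ℕ}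

theorem congr (h : IsTable U K l H S D) (hS : ∀ j x, S' j x ↔ S j x) : IsTable U K l H S' D := by
  obtain rfl : S' = S := funext₂ fun j x => propext (hS j x)
  exact h

theorem empty (hS : ∀ j x, ¬S j x) : IsTable U K l H S fun _ => 0 :=
  ⟨fun j x _ => by simp [hS], fun j β c _ _ _ => by simp [hS]⟩

theorem entry_of_mem (h : IsTable U K l H S D) {j x : ℕ} (hx : x < U) (hS : S j x) :
    D (cell U j x (U - 1)) = H j x := by
  rw [h.entry j x hx, if_pos hS]

theorem update_of_lt (h : IsTable U K l H S D) {a v : ℕ} (ha : a + 1 < U) :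
    IsTable U K l H S (Function.update D a v) where
  entry j x hx := by
    have := le_cell (j := j) (x := x) (c := U - 1) (U := U) (.inr (by omega))
    rw [Function.update_of_ne (by omega), h.entry j x hx]
  mark j β c hβ hβ' hc := by
    have := le_cell (j := j) (x := β) (c := c) (U := U) (.inl hβ)
    rw [Function.update_of_ne (by omega), h.mark j β c hβ hβ' hc]

open Classical in
theorem insert (h : IsTable U K l H S D) {j x : ℕ} (hx : x < U) (hβ : (x + K) / l < U)
    (hH : H j x < U - 1) (hS : ∀ j' x', S' j' x' ↔ S j' x' ∨ j' = j ∧ x' = x) :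
    IsTable U K l H S' (Function.update (Function.update D (cell U j x (U - 1)) (H j x))
      (cell U j ((x + K) / l) (H j x)) 1) where
  entry j' x' hx' := by
    have hmark : cell U j' x' (U - 1) ≠ cell U j ((x + K) / l) (H j x) := fun e => by
      have := (cell_inj hx' (by omega) hβ (by omega) e).2.2
      omega
    rw [Function.update_of_ne hmark, Function.update_apply]
    by_cases hnew : j' = j ∧ x' = x
    · obtain ⟨rfl, rfl⟩ := hnew
      rw [if_pos rfl, if_pos ((hS _ _).2 (.inr ⟨rfl, rfl⟩))]
    · have hne : cell U j' x' (U - 1) ≠ cell U j x (U - 1) := fun e => by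
        obtain ⟨hj, hx, -⟩ := cell_inj hx' (by omega) hx (by omega) e
        exact hnew ⟨hj, hx⟩
      rw [if_neg hne, h.entry _ _ hx']
      exact if_congr (by simp only [hS, hnew, or_false]) rfl rfl
  mark j' β c hβ₁ hβ' hc := by
    have hentry : cell U j' β c ≠ cell U j x (U - 1) := fun e => by
      have := (cell_inj hβ' (by omega) hx (by omega) e).2.2
      omega
    rw [Function.update_apply, Function.update_of_ne hentry, h.mark _ _ _ hβ₁ hβ' hc]
    by_cases hnew : j' = j ∧ (x + K) / l = β ∧ H j x = c
    · obtain ⟨rfl, rfl, rfl⟩ := hnew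
      rw [if_pos rfl, if_pos ⟨x, (hS _ _).2 (.inr ⟨rfl, rfl⟩), rfl, rfl⟩]
    · have hne : cell U j' β c ≠ cell U j ((x + K) / l) (H j x) := fun e => by
        obtain ⟨hj, hβ, hc⟩ := cell_inj hβ' (by omega) hβ (by omega) e
        exact hnew ⟨hj, hβ.symm, hc.symm⟩
      have hold : ∀ y, S' j' y ∧ (y + K) / l = β ∧ H j' y = c ↔
          S j' y ∧ (y + K) / l = β ∧ H j' y = c := fun y => by
        rw [hS]
        refine ⟨fun ⟨hy, hyβ, hyc⟩ => ⟨hy.resolve_right ?_, hyβ, hyc⟩, fun hy => ⟨.inl hy.1, hy.2⟩⟩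
        rintro ⟨rfl, rfl⟩
        exact hnew ⟨rfl, hyβ, hyc⟩
      rw [if_neg hne]
      exact if_congr (exists_congr fun y => (hold y).symm) rfl rfl

end IsTable

/-- The numerical assumptions under which the programs do not overflow when they use a table with
base `U` and the multiplicative hash function with divisor `D`. -/
structure Sizes (w n k l σ U D : ℕ) : Prop where
  one_le : 1 ≤ l
  block_le : l ≤ k
  bound_le : k ≤ n
  size_le : 16 * n + 16 ≤ U
  alphabet_le : σ + 3 ≤ U
  pow_lt : U ^ 3 < 2 ^ w
  divisor_pos : 0 < D
  divisor_lt : D < 2 ^ w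
  hash_le : (2 ^ w - 1) / D + 3 ≤ U

namespace Sizes

variable {w n k l σ U D : ℕ}

theorem mul_self_lt (S : Sizes w n k l σ U D) : U * U < 2 ^ w := by
  have hU := S.size_le
  rw [← sq]
  exact (Nat.pow_le_pow_right (by omega) (by norm_num)).trans_lt S.pow_lt

theorem bounds (S : Sizes w n k l σ U D) :
    1 ≤ l ∧ l ≤ k ∧ k ≤ n ∧ 16 * n + 16 ≤ U ∧ U * 16 < 2 ^ w := by
  have hU := S.size_le
  exact ⟨S.one_le, S.block_le, S.bound_le, hU,
    (Nat.mul_le_mul_left U (by omega)).trans_lt S.mul_self_lt⟩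

theorem wordLength_pos (S : Sizes w n k l σ U D) : 0 < w := by
  have := S.divisor_pos
  have := S.divisor_lt
  rcases Nat.eq_zero_or_pos w with rfl | hw
  · rw [pow_zero] at *
    omega
  · exact hw

theorem fingerprint_add_two_le (S : Sizes w n k l σ U D) {f : ℕ → ℕ} (hf : ∀ x, f x ≤ σ)
    (r : ℕ → ℕ) (j x : ℕ) : fingerprint (2 ^ w) U D r f j x + 2 ≤ U :=
  _root_.fingerprint_add_two_le (by positivity) S.hash_le
    (fun x => (Nat.add_le_add_right (hf x) 3).trans S.alphabet_le) j x

end Sizes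

open WordExp (reg get)

/-! ### The preprocessing program -/

namespace Register

abbrev size : ℕ := 0
abbrev bound : ℕ := 1
abbrev block : ℕ := 2
abbrev alphabet : ℕ := 3
abbrev temp : ℕ := 4
abbrev base : ℕ := 5
abbrev divisor : ℕ := 6
abbrev offset : ℕ := 7
abbrev level : ℕ := 8
abbrev width : ℕ := 9
abbrev pos : ℕ := 10
abbrev code : ℕ := 11
abbrev word : ℕ := 12
abbrev left : ℕ := 13
abbrev right : ℕ := 14
abbrev newLevel : ℕ := 15
abbrev more : ℕ := 16

end Register

namespace WordExp

/-- The address of a table entry. -/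
def cell (j x c : WordExp) : WordExp := (j * reg Register.base + x) * reg Register.base + c

theorem Evals.cell {w U a b d : ℕ} {h : Config} {j x c : WordExp} (hU : h.reg Register.base = U)
    (hw : U ^ 3 < 2 ^ w) (hj : j.Evals w h a) (hx : x.Evals w h b) (hc : c.Evals w h d)
    (ha : a < U) (hb : b < U) (hd : d < U) : (cell j x c).Evals w h (_root_.cell U a b d) := by
  have hab : a * U + b < U * U := mul_add_lt_mul ha hb
  have habd : (a * U + b) * U + d < U ^ 3 := (mul_add_lt_mul hab hd).trans_eq (by ring)
  have hbase : (WordExp.reg Register.base).Evals w h U :=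
    .reg hU ((Nat.le_self_pow three_ne_zero U).trans_lt hw)
  have hle : a * U + b ≤ (a * U + b) * U := Nat.le_mul_of_pos_right _ (by omega)
  exact (((hj.mul hbase rfl).add hx rfl).mul hbase rfl).add hc rfl (habd.trans hw)

/-- The address of the fingerprint of a window. -/
def entry (j x : WordExp) : WordExp := cell j x (reg Register.base - 1)

theorem Evals.entry {w U a b : ℕ} {h : Config} {j x : WordExp} (hU : h.reg Register.base = U)
    (hw : U ^ 3 < 2 ^ w) (hj : j.Evals w h a) (hx : x.Evals w h b) (ha : a < U) (hb : b < U) :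
    (entry j x).Evals w h (_root_.cell U a b (U - 1)) := by
  have : U ≤ U ^ 3 := Nat.le_self_pow three_ne_zero U
  exact .cell hU hw hj hx (.sub (.reg hU) .ofNat (by omega)) ha hb (by omega)

end WordExp

open Register

/-- Enter the window at position `pos` on level `newLevel`, whose fingerprint is `code`. -/
def emit : Prog :=
  put 1 (.entry (reg newLevel) (reg pos)) (reg code) ;;
  put 1 (.cell (reg newLevel) ((reg pos + reg offset) / reg block) (reg code)) 1

/-- Enter the letter before position `pos`. -/
def letterBody : Prog :=
  pos ::= reg pos - 1 ;;
  code ::= get 0 (reg pos) + 1 ;;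
  emit

/-- Enter the union of two adjacent windows of level `level`; the product of their combined code
with the random word is meant modulo `2 ^ w`. -/
def windowBody : Prog :=
  pos ::= reg pos - 1 ;;
  left ::= get 1 (.entry (reg level) (reg pos)) ;;
  right ::= get 1 (.entry (reg level) (reg pos + reg width)) ;;
  code ::= 1 + reg word * (reg left * reg base + reg right) / reg divisor ;;
  emit

/-- Enter all letters. -/
def firstLevel : Prog :=
  newLevel ::= 0 ;;
  pos ::= reg size ;;
  .while pos letterBody

/-- Find out whether there is a further level. -/
def moreLevels : Prog := more ::= .op .lt (2 * reg width) (reg size + 1)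

/-- Enter all windows of the level after `level`. -/
def nextLevel : Prog :=
  .rand word ;;
  newLevel ::= reg level + 1 ;;
  pos ::= reg size + 1 - 2 * reg width ;;
  .while pos windowBody ;;
  level ::= reg newLevel ;;
  width ::= 2 * reg width ;;
  moreLevels

/-- Store a code of the whole string, the number of levels and the base. -/
def finish : Prog :=
  put 1 0 (get 1 (.entry (reg level) 0) * reg base +
    get 1 (.entry (reg level) (reg size - reg width))) ;;
  put 1 1 (reg level + 1) ;;
  put 1 2 (reg base)

/-- Compute the base of the table and the divisor of the hash function; the difference `0 - 1` is
the largest word. -/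
def setup : Prog :=
  temp ::= 4 * (reg size * reg alphabet) ;;
  temp ::= reg temp * reg temp ;;
  temp ::= reg temp * reg temp ;;
  base ::= reg temp + 4 ;;
  divisor ::= (0 - 1) / reg temp ;;
  offset ::= reg bound + reg block

/-- The preprocessing. -/
def preprocess : Prog :=
  setup ;; firstLevel ;; level ::= 0 ;; width ::= 1 ;; moreLevels ;; .while more nextLevel ;; finish

/-- The registers that stay fixed during the preprocessing of the string `f`. -/
structure PreBase (n l U D K : ℕ) (f : ℕ → ℕ) (h : Config) : Prop where
  size : h.reg size = n
  block : h.reg block = l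
  base : h.reg base = U
  divisor : h.reg divisor = D
  offset : h.reg offset = K
  string : h.mem 0 = f

/-- The windows that have been entered while level `j` is under way, from position `m` on. -/
def Entered (n j m j' x : ℕ) : Prop := x + 2 ^ j' ≤ n ∧ (j' < j ∨ j' = j ∧ m ≤ x)

theorem entered_iff_succ {n j m : ℕ} (hm : m + 2 ^ j ≤ n) (j' x : ℕ) :
    Entered n j m j' x ↔ Entered n j (m + 1) j' x ∨ j' = j ∧ x = m := by
  unfold Entered
  constructor
  · rintro ⟨hx, hj⟩
    omega
  · rintro (⟨hx, hj⟩ | ⟨rfl, rfl⟩) <;> omega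

theorem entered_succ_iff {n j m : ℕ} (hm : n < m + 2 ^ (j + 1)) (j' x : ℕ) :
    Entered n (j + 1) m j' x ↔ Entered n j 0 j' x := by
  unfold Entered
  constructor
  · rintro ⟨hx, hj | ⟨rfl, hj⟩⟩ <;> omega
  · rintro ⟨hx, hj⟩
    omega

theorem not_entered_zero {n m : ℕ} (hm : n ≤ m) (j' x : ℕ) : ¬Entered n 0 m j' x := by
  rintro ⟨hx, hj | ⟨rfl, hj⟩⟩ <;> omega

/-- The state of the loop over the letters before position `m`. -/
structure LetterState (n l U D K : ℕ) (f : ℕ → ℕ) (H : ℕ → ℕ → ℕ) (m : ℕ) (h : Config) : Prop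
    extends PreBase n l U D K f h where
  le : m ≤ n
  newLevel : h.reg newLevel = 0
  position : h.reg pos = m
  tape : h.pos = 0
  table : IsTable U K l H (Entered n 0 m) (h.mem 1)

/-- The state of the loop over the windows of level `j + 1` before position `m`, where `r` is the
random word for this level. -/
structure WindowState (n l U D K : ℕ) (f : ℕ → ℕ) (H : ℕ → ℕ → ℕ) (j r m : ℕ) (h : Config) : Prop
    extends PreBase n l U D K f h where
  le : m + 2 ^ (j + 1) ≤ n + 1
  level : h.reg level = j
  width : h.reg width = 2 ^ j
  word : h.reg word = r
  newLevel : h.reg newLevel = j + 1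
  position : h.reg pos = m
  tape : h.pos = j + 1
  table : IsTable U K l H (Entered n (j + 1) m) (h.mem 1)

/-- The state after level `j` of the preprocessing. -/
structure LevelState (n l U D K : ℕ) (f : ℕ → ℕ) (H : ℕ → ℕ → ℕ) (j : ℕ) (h : Config) : Prop
    extends PreBase n l U D K f h where
  level : h.reg level = j
  width : h.reg width = 2 ^ j
  more : h.reg more = if 2 * 2 ^ j < n + 1 then 1 else 0
  tape : h.pos = j
  table : IsTable U K l H (Entered n j 0) (h.mem 1)

/-- What the preprocessing leaves in array `1`: the table, overwritten in its first three entries,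
which the table does not use.  The fingerprints are nonzero and different from the last digit. -/
structure IsOutput (U K l n : ℕ) (H : ℕ → ℕ → ℕ) (E : ℕ → ℕ) : Prop where
  table : IsTable U K l H (fun j x => j ≤ Nat.log 2 n ∧ x + 2 ^ j ≤ n) E
  whole : E 0 = H (Nat.log 2 n) 0 * U + H (Nat.log 2 n) (n - 2 ^ Nat.log 2 n)
  levels : E 1 = Nat.log 2 n + 1
  base : E 2 = U
  one_le : ∀ j x, 1 ≤ H j x
  add_two_le : ∀ j x, H j x + 2 ≤ U

section Execution

variable {w n k l σ U D : ℕ} {ω : Tape w} {f : ℕ → ℕ} {H : ℕ → ℕ → ℕ} {h : Config}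
  {Q : Config → Prop}

theorem haltsWithin_emit (S : Sizes w n k l σ U D) (hb : PreBase n l U D (k + l) f h)
    {V V' : ℕ → ℕ → Prop} {j x : ℕ} (hj : h.reg newLevel = j) (hx : h.reg pos = x)
    (hc : h.reg code = H j x) (hjn : j ≤ n) (hxn : x ≤ n) (hH : H j x + 2 ≤ U)
    (ht : IsTable U (k + l) l H V (h.mem 1))
    (hV : ∀ j' x', V' j' x' ↔ V j' x' ∨ j' = j ∧ x' = x)
    (hQ : ∀ E, IsTable U (k + l) l H V' E → Q { h with mem := Function.update h.mem 1 E }) :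
    HaltsWithin ω emit h 50 Q := by
  obtain ⟨hl, hlk, hkn, hU, hUw⟩ := S.bounds
  have hβ : (x + (k + l)) / l < U := (Nat.div_le_self ..).trans_lt (by omega)
  refine .of_le (by decide) <| .put_seq (v := H j x)
    (.entry (a := j) (b := x) hb.base S.pow_lt (.reg hj) (.reg hx) (by omega) (by omega))
    (.reg hc) <| .put
    (.cell (a := j) (b := (x + (k + l)) / l) (d := H j x) hb.base S.pow_lt (.reg hj)
      (.div (.add (.reg hx) (.reg hb.offset) rfl) (.reg hb.block)) (.reg hc)
      (by omega) hβ (by omega)) .ofNat ?_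
  simpa [Config.setMem] using hQ _ (ht.insert (by omega) hβ (by omega) hV)

theorem haltsWithin_letterBody (S : Sizes w n k l σ U D) (hf : ∀ x, f x ≤ σ)
    (hH : ∀ x, H 0 x = f x + 1) {m : ℕ} (hs : LetterState n l U D (k + l) f H (m + 1) h) :
    HaltsWithin ω letterBody h 70 (LetterState n l U D (k + l) f H m) := by
  obtain ⟨-, -, -, hU, hUw⟩ := S.bounds
  have hm := hs.le
  have hσ := S.alphabet_le
  have hfm := hf m
  have hHm := hH m
  refine .of_le (by decide) <| .assign_seq (v := m)
    (.sub (.reg hs.position) .ofNat rfl) <| .assign_seq (v := H 0 m)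
    (.add (.get (.reg (v := m) rfl) (congrFun hs.string m) (by omega)) .ofNat hHm.symm) <|
    haltsWithin_emit (j := 0) (x := m) S { hs.toPreBase with } hs.newLevel rfl rfl (by omega)
      (by omega) (by omega) hs.table (entered_iff_succ hm) fun E hE => ?_
  exact { hs with le := by omega, position := rfl, table := hE }

theorem haltsWithin_windowBody (S : Sizes w n k l σ U D) (hf : ∀ x, f x ≤ σ)
    (hH : H = fingerprint (2 ^ w) U D (tapeWords ω) f) {j m : ℕ}
    (hs : WindowState n l U D (k + l) f H j (ω j) (m + 1) h) :
    HaltsWithin ω windowBody h 150 (WindowState n l U D (k + l) f H j (ω j) m) := by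
  obtain ⟨hl, hlk, hkn, hU, hUw⟩ := S.bounds
  have hle : ∀ j x, H j x + 2 ≤ U := fun j x => hH ▸ S.fingerprint_add_two_le hf _ j x
  have hm := hs.le
  have hj : j < 2 ^ j := Nat.lt_two_pow_self
  have hleft := hle j m
  have hright := hle j (m + 2 ^ j)
  have hnew := hle (j + 1) m
  have hcode : H j m * U + H j (m + 2 ^ j) < U * U := mul_add_lt_mul (by omega) (by omega)
  have hUU := S.mul_self_lt
  have hstep : 1 + ω j * (H j m * U + H j (m + 2 ^ j)) % 2 ^ w / D = H (j + 1) m := by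
    rw [hH]; rfl
  refine .of_le (by decide) <| .assign_seq (v := m)
    (.sub (.reg hs.position) .ofNat rfl) <| .assign_seq (v := H j m)
    (.get (.entry (a := j) (b := m) hs.base S.pow_lt (.reg hs.level) (.reg (v := m) rfl)
      (by omega) (by omega)) (hs.table.entry_of_mem (by omega) ⟨by omega, by omega⟩) (by omega)) <|
    .assign_seq (v := H j (m + 2 ^ j))
    (.get (.entry (a := j) (b := m + 2 ^ j) hs.base S.pow_lt (.reg hs.level)
      (.add (.reg (v := m) rfl) (.reg hs.width) rfl) (by omega) (by omega))
      (hs.table.entry_of_mem (by omega) ⟨by omega, by omega⟩) (by omega)) <|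
    .assign_seq (v := H (j + 1) m)
    (.add .ofNat (.div (.op .mul (.reg hs.word) (.add (.mul (.reg (v := H j m) rfl) (.reg hs.base)
      rfl) (.reg (v := H j (m + 2 ^ j)) rfl) rfl)) (.reg hs.divisor S.divisor_lt)) hstep) <|
    haltsWithin_emit (j := j + 1) (x := m) S { hs.toPreBase with } hs.newLevel rfl rfl (by omega)
      (by omega) (by omega) hs.table (entered_iff_succ (by omega)) fun E hE => ?_
  exact { hs with le := by omega, position := rfl, table := hE }

theorem haltsWithin_firstLevel (S : Sizes w n k l σ U D) (hf : ∀ x, f x ≤ σ)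
    (hH : ∀ x, H 0 x = f x + 1) (hb : PreBase n l U D (k + l) f h) (hp : h.pos = 0)
    (hm : h.mem 1 = fun _ => 0) :
    HaltsWithin ω firstLevel h (n * 71 + 10) (LetterState n l U D (k + l) f H 0) := by
  obtain ⟨-, -, -, hU, hUw⟩ := S.bounds
  refine .of_le (T := 3 + (4 + (n * 71 + 1))) (by omega) <| .assign_seq .ofNat <|
    .assign_seq (.reg hb.size) <| .loop (LetterState n l U D (k + l) f H)
      (fun _ hs => hs.position) (fun _ _ hs => hs.position.trans_ne (Nat.succ_ne_zero _))
      (fun _ _ hs => haltsWithin_letterBody S hf hH hs) ?_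
  exact { hb with
    le := le_rfl, newLevel := rfl, position := rfl, tape := hp
    table := hm ▸ .empty (not_entered_zero le_rfl) }

theorem haltsWithin_moreLevels (S : Sizes w n k l σ U D) {j : ℕ} (hn : h.reg size = n)
    (hwidth : h.reg width = 2 ^ j) (hj : 2 ^ j ≤ n)
    (hQ : Q (h.setReg more (if 2 * 2 ^ j < n + 1 then 1 else 0))) :
    HaltsWithin ω moreLevels h 12 Q := by
  obtain ⟨-, -, -, hU, hUw⟩ := S.bounds
  exact .of_le (by decide) <| .assign (.compareLT (.mul .ofNat (.reg hwidth) rfl)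
    (.add (.reg hn) .ofNat rfl) S.wordLength_pos) hQ

theorem haltsWithin_nextLevel (S : Sizes w n k l σ U D) (hf : ∀ x, f x ≤ σ)
    (hH : H = fingerprint (2 ^ w) U D (tapeWords ω) f) {j : ℕ} (hj : 2 ^ (j + 1) ≤ n)
    (hs : LevelState n l U D (k + l) f H j h) :
    HaltsWithin ω nextLevel h (n * 151 + 50) (LevelState n l U D (k + l) f H (j + 1)) := by
  obtain ⟨-, -, -, hU, hUw⟩ := S.bounds
  have hlt : j + 1 < 2 ^ (j + 1) := Nat.lt_two_pow_self
  have hpow : 2 ^ (j + 1) = 2 * 2 ^ j := by ring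
  have htime : (n + 1 - 2 * 2 ^ j) * 151 ≤ n * 151 := Nat.mul_le_mul_right _ (by omega)
  have htape : (ω h.pos : ℕ) = ω j := by rw [hs.tape]
  refine .of_le (T := 1 + (6 + (11 + ((n + 1 - 2 * 2 ^ j) * 151 + 1 + (4 + (6 + 12))))))
    (by omega) <| .rand_seq <| .assign_seq (v := j + 1) (.add (.reg hs.level) .ofNat rfl) <|
    .assign_seq (v := n + 1 - 2 * 2 ^ j) (.sub (u := n + 1) (v := 2 * 2 ^ j)
      (.add (.reg hs.size) .ofNat rfl) (.mul .ofNat (.reg hs.width) rfl) (by omega)) <|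
    .seq (.loop (WindowState n l U D (k + l) f H j (ω j)) (fun _ hs => hs.position)
      (fun _ _ hs => hs.position.trans_ne (Nat.succ_ne_zero _))
      (fun _ _ hs => haltsWithin_windowBody S hf hH hs) ?_) fun h' hs' =>
    .assign_seq (.reg hs'.newLevel) <|
    .assign_seq (v := 2 ^ (j + 1)) (.mul .ofNat (.reg hs'.width) hpow.symm) <|
    haltsWithin_moreLevels S hs'.size rfl hj { hs' with level := rfl, width := rfl, more := rfl }
  exact { hs with
    le := by omega, word := htape, newLevel := rfl, position := rfl
    tape := congrArg (· + 1) hs.tape, table := hs.table.congr (entered_succ_iff (by omega)) }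

theorem haltsWithin_finish (S : Sizes w n k l σ U D) (hf : ∀ x, f x ≤ σ)
    (hH : H = fingerprint (2 ^ w) U D (tapeWords ω) f)
    (hs : LevelState n l U D (k + l) f H (Nat.log 2 n) h) :
    HaltsWithin ω finish h 70 fun h' => IsOutput U (k + l) l n H (h'.mem 1) := by
  obtain ⟨hl, hlk, hkn, hU, hUw⟩ := S.bounds
  have hle : ∀ j x, H j x + 2 ≤ U := fun j x => hH ▸ S.fingerprint_add_two_le hf _ j x
  have hpos : ∀ j x, 1 ≤ H j x := fun j x => hH ▸ fingerprint_pos j x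
  have hpow : 2 ^ Nat.log 2 n ≤ n := Nat.pow_log_le_self 2 (by omega)
  have hlog : Nat.log 2 n < 2 ^ Nat.log 2 n := Nat.lt_two_pow_self
  have hfirst := hle (Nat.log 2 n) 0
  have hlast := hle (Nat.log 2 n) (n - 2 ^ Nat.log 2 n)
  have hcode : H (Nat.log 2 n) 0 * U + H (Nat.log 2 n) (n - 2 ^ Nat.log 2 n) < U * U :=
    mul_add_lt_mul (by omega) (by omega)
  have hUU := S.mul_self_lt
  refine .of_le (by decide) <| .put_seq (a := 0) .ofNat
    (.add (.mul (.get (.entry (b := 0) hs.base S.pow_lt (.reg hs.level) .ofNat (by omega)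
      (by omega)) (hs.table.entry_of_mem (by omega) ⟨by omega, by omega⟩) (by omega))
      (.reg hs.base) rfl)
      (.get (.entry (b := n - 2 ^ Nat.log 2 n) hs.base S.pow_lt (.reg hs.level)
        (.sub (.reg hs.size) (.reg hs.width) (by omega)) (by omega) (by omega))
        (hs.table.entry_of_mem (by omega) ⟨by omega, by omega⟩) (by omega)) rfl) <|
    .put_seq (a := 1) .ofNat (.add (.reg hs.level) .ofNat rfl) <|
    .put (a := 2) .ofNat (.reg hs.base) ⟨?_, rfl, rfl, rfl, hpos, hle⟩
  refine IsTable.congr (S := Entered n (Nat.log 2 n) 0) ?_ fun j x => by unfold Entered; omega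
  exact ((hs.table.update_of_lt (by omega)).update_of_lt (by omega)).update_of_lt (by omega)

end Execution

/-- The base of the table for a string of length `n` over `σ` letters. -/
def tableBase (n σ : ℕ) : ℕ := (4 * (n * σ)) ^ 4 + 4

/-- The divisor of the hash function, which makes the hash values smaller than the base. -/
def hashDiv (w n σ : ℕ) : ℕ := (2 ^ w - 1) / (4 * (n * σ)) ^ 4

/-- The fingerprints of the windows of a string. -/
def stringFingerprint {w n σ : ℕ} (ω : Tape w) (A : Fin n → Fin σ) : ℕ → ℕ → ℕ :=
  fingerprint (2 ^ w) (tableBase n σ) (hashDiv w n σ) (tapeWords ω) (stringArray A)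

theorem stringArray_le {n σ : ℕ} (A : Fin n → Fin σ) (x : ℕ) : stringArray A x ≤ σ := by
  unfold stringArray
  split_ifs with hx
  · exact (A ⟨x, hx⟩).2.le
  · exact Nat.zero_le σ

section Execution

variable {w n k l σ : ℕ} {ω : Tape w}

theorem haltsWithin_setup (S : Sizes w n k l σ (tableBase n σ) (hashDiv w n σ))
    (A : Fin n → Fin σ) :
    HaltsWithin ω setup (preInit k l A) 60 fun h =>
      PreBase n l (tableBase n σ) (hashDiv w n σ) (k + l) (stringArray A) h ∧
        h.mem 1 = (fun _ => 0) ∧ h.pos = 0 := by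
  obtain ⟨hl, hlk, hkn, hU, hUw⟩ := S.bounds
  have hσ := S.alphabet_le
  set t := 4 * (n * σ) with ht
  have hbase : tableBase n σ = t * t * (t * t) + 4 := by rw [tableBase]; ring
  have hdiv : (2 ^ w - 1) / (t * t * (t * t)) = hashDiv w n σ := by
    rw [hashDiv, ← ht]; ring_nf
  have ht₁ : t ≤ t * t := Nat.le_mul_self t
  have ht₂ : t * t ≤ t * t * (t * t) := Nat.le_mul_self _
  have hmax : WordOp.sub.eval w 0 1 = 2 ^ w - 1 := by
    rw [WordOp.eval, Nat.mod_eq_of_lt (a := 1) (by omega), zero_add, Nat.mod_eq_of_lt (by omega)]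
  refine .of_le (by decide) <| .assign_seq (v := t)
    (.mul .ofNat (.mul (u := n) (v := σ) (.reg rfl) (.reg rfl) rfl) rfl) <|
    .assign_seq (v := t * t) (.mul (.reg (v := t) rfl) (.reg (v := t) rfl) rfl) <|
    .assign_seq (v := t * t * (t * t))
      (.mul (.reg (v := t * t) rfl) (.reg (v := t * t) rfl) rfl) <|
    .assign_seq (.add (.reg (v := t * t * (t * t)) rfl) .ofNat hbase.symm) <|
    .assign_seq (v := hashDiv w n σ)
      (hdiv ▸ hmax ▸ .div (.op .sub .ofNat .ofNat) (.reg (v := t * t * (t * t)) rfl)) <|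
    .assign (.add (u := k) (v := l) (.reg rfl) (.reg rfl) rfl) ?_
  exact ⟨⟨rfl, rfl, rfl, rfl, rfl, rfl⟩, rfl, rfl⟩

theorem haltsWithin_levels (S : Sizes w n k l σ (tableBase n σ) (hashDiv w n σ))
    (A : Fin n → Fin σ) {h : Config} {H : ℕ → ℕ → ℕ} (hH : H = stringFingerprint ω A)
    (hs : LevelState n l (tableBase n σ) (hashDiv w n σ) (k + l) (stringArray A) H 0 h) :
    HaltsWithin ω (.while more nextLevel) h (Nat.log 2 n * (n * 151 + 50 + 1) + 1)
      (LevelState n l (tableBase n σ) (hashDiv w n σ) (k + l) (stringArray A) H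
        (Nat.log 2 n)) := by
  obtain ⟨hl, hlk, hkn, -, -⟩ := S.bounds
  have hmore : ∀ j, 2 * 2 ^ j < n + 1 ↔ j < Nat.log 2 n := fun j => by
    rw [← pow_succ', Nat.lt_succ_iff, ← Nat.le_log_iff_pow_le one_lt_two (by omega),
      Nat.succ_le_iff]
  let Inv (m : ℕ) (h : Config) : Prop := ∃ j, j + m = Nat.log 2 n ∧
    LevelState n l (tableBase n σ) (hashDiv w n σ) (k + l) (stringArray A) H j h
  refine (HaltsWithin.loop Inv ?_ ?_ ?_ ⟨0, zero_add _, hs⟩).mono le_rfl ?_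
  · rintro h ⟨j, hj, hs⟩
    rw [hs.more, if_neg (by rw [hmore]; omega)]
  · rintro m h ⟨j, hj, hs⟩
    rw [hs.more, if_pos (by rw [hmore]; omega)]
    exact one_ne_zero
  · rintro m h ⟨j, hj, hs⟩
    have hle : 2 ^ (j + 1) ≤ n := by
      rw [pow_succ', ← Nat.lt_succ_iff, Nat.succ_eq_add_one, hmore]; omega
    exact (haltsWithin_nextLevel S (stringArray_le A) hH hle hs).mono le_rfl
      fun h' hs' => ⟨j + 1, by omega, hs'⟩
  · rintro h ⟨j, rfl, hs⟩
    exact hs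

theorem haltsWithin_preprocess (S : Sizes w n k l σ (tableBase n σ) (hashDiv w n σ))
    (A : Fin n → Fin σ) :
    HaltsWithin ω preprocess (preInit k l A)
      (60 + (n * 71 + 10 + (3 + (3 + (12 + (Nat.log 2 n * (n * 151 + 50 + 1) + 1 + 70))))))
      fun h => IsOutput (tableBase n σ) (k + l) l n (stringFingerprint ω A) (h.mem 1) := by
  obtain ⟨hl, hlk, hkn, hU, hUw⟩ := S.bounds
  exact .seq (haltsWithin_setup S A) fun h hs => .seq
    (haltsWithin_firstLevel S (stringArray_le A) (fun _ => rfl) hs.1 hs.2.2 hs.2.1) fun h hs =>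
    .assign_seq .ofNat <| .assign_seq .ofNat <| .seq
    (haltsWithin_moreLevels (j := 0) S hs.size rfl (by omega)
      { hs with level := rfl, width := rfl, more := rfl }) fun h hs => .seq
    (haltsWithin_levels S A rfl hs) fun h hs => haltsWithin_finish S (stringArray_le A) rfl hs

theorem exec_preprocess (S : Sizes w n k l σ (tableBase n σ) (hashDiv w n σ)) (ω : Tape w)
    (A : Fin n → Fin σ) :
    ∃ t s, Exec w ω preprocess (preInit k l A) t s ∧ t ≤ 1000 * n * (Nat.log 2 n + 1) ∧
      IsOutput (tableBase n σ) (k + l) l n (stringFingerprint ω A) (s.mem 1) := by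
  obtain ⟨hl, hlk, hkn, -, -⟩ := S.bounds
  obtain ⟨t, s, h, he, ht, hs, hout⟩ := haltsWithin_preprocess S A (ω := ω) _ .refl
  refine ⟨t, s, he, ht.trans ?_, hs.mem ▸ hout⟩
  nlinarith [Nat.zero_le (Nat.log 2 n)]

end Execution

/-! ### The query program -/

/-- The tables show a pair of equal fingerprints of windows of length `2 ^ j`, the first one at
position `m`, the second one on a diagonal that block `b` contains or may contain. -/
def Hit (n k l : ℕ) (H H' : ℕ → ℕ → ℕ) (j m b : ℕ) : Prop :=
  m + 2 ^ j ≤ n ∧ ∃ y, y + 2 ^ j ≤ n ∧ NearBlock (k + l) l b m y ∧ H' j y = H j m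

namespace IsOutput

variable {U K k l n j m x β b c : ℕ} {H H' : ℕ → ℕ → ℕ} {E E' : ℕ → ℕ}

theorem entry_add_two_le (hE : IsOutput U K l n H E) (hx : x < U) :
    E (cell U j x (U - 1)) + 2 ≤ U := by
  have := hE.add_two_le j x
  rw [hE.table.entry j x hx]
  split_ifs <;> omega

theorem whole_lt {w σ D : ℕ} (hE : IsOutput U K l n H E) (S : Sizes w n k l σ U D) :
    E 0 < 2 ^ w := by
  have h := hE.add_two_le (Nat.log 2 n) 0
  have h' := hE.add_two_le (Nat.log 2 n) (n - 2 ^ Nat.log 2 n)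
  exact hE.whole ▸ (mul_add_lt_mul (by omega) (by omega)).trans S.mul_self_lt

theorem mark_le_one (hE : IsOutput U K l n H E) (hβ : 1 ≤ β) (hβ' : β < U) (hc : c < U - 1) :
    E (cell U j β c) ≤ 1 := by
  rw [hE.table.mark j β c hβ hβ' hc]
  split_ifs <;> omega

theorem mark_pos_iff (hE : IsOutput U K l n H E) (hj : j ≤ Nat.log 2 n) (hβ : 1 ≤ β) (hβ' : β < U)
    (hc : c < U - 1) :
    0 < E (cell U j β c) ↔ ∃ y, y + 2 ^ j ≤ n ∧ (y + K) / l = β ∧ H j y = c := by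
  rw [hE.table.mark j β c hβ hβ' hc]
  split_ifs with h
  · exact iff_of_true one_pos (by simpa only [hj, true_and] using h)
  · exact iff_of_false (lt_irrefl 0) (by simpa only [hj, true_and] using h)

theorem marks_pos_iff_hit (hE : IsOutput U K l n H E) (hE' : IsOutput U (k + l) l n H' E')
    (hj : j ≤ Nat.log 2 n) (hm : m < U) (hb : 1 ≤ b) (hmb : m / l + (b + 1) < U) :
    0 < E' (cell U j (m / l + b) (E (cell U j m (U - 1)))) +
        E' (cell U j (m / l + (b + 1)) (E (cell U j m (U - 1)))) ↔ Hit n k l H H' j m b := by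
  have hv := hE.entry_add_two_le (j := j) hm
  have hml := Nat.zero_le (m / l)
  rw [Nat.add_pos_iff_pos_or_pos, hE'.mark_pos_iff hj (by omega) (by omega) (by omega),
    hE'.mark_pos_iff hj (by omega) hmb (by omega), hE.table.entry j m hm]
  by_cases hmn : m + 2 ^ j ≤ n
  · rw [if_pos ⟨hj, hmn⟩, ← exists_or, Hit, and_iff_right hmn]
    exact exists_congr fun y => by rw [NearBlock, add_assoc]; tauto
  · have hpos : ∀ y, H' j y ≠ 0 := fun y => Nat.ne_of_gt (hE'.one_le j y)
    simp only [Hit, hmn, and_false, if_false, false_and, hpos, exists_false, or_self]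

end IsOutput

namespace Register

abbrev blocks : ℕ := 17
abbrev levels : ℕ := 18
abbrev roundsLeft : ℕ := 19
abbrev roundIndex : ℕ := 20
abbrev frontBlock : ℕ := 21
abbrev jumpLength : ℕ := 22
abbrev scanLeft : ℕ := 23
abbrev marks : ℕ := 24
abbrev best : ℕ := 25

end Register

/-- Look for windows of level `level` that continue from position `pos` on block `frontBlock`. -/
def scanBody : Prog :=
  code ::= get 2 (.entry (reg level) (reg pos)) ;;
  marks ::= get 3 (.cell (reg level) (reg pos / reg block + reg frontBlock) (reg code)) +
    get 3 (.cell (reg level) (reg pos / reg block + (reg frontBlock + 1)) (reg code)) ;;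
  jumpLength ::= .max (reg jumpLength) (.op .lt 0 (reg marks) * reg width) ;;
  level ::= reg level + 1 ;;
  width ::= 2 * reg width ;;
  scanLeft ::= reg scanLeft - 1

/-- Compute the jump from position `pos` on block `frontBlock`. -/
def scan : Prog :=
  jumpLength ::= 0 ;;
  scanLeft ::= reg levels ;;
  level ::= 0 ;;
  width ::= 1 ;;
  .while scanLeft scanBody

/-- The address of the front after round `i` on block `b`. -/
def WordExp.frontCell (i b : WordExp) : WordExp := i * reg base + b

theorem WordExp.Evals.frontCell {w U a e : ℕ} {h : Config} {i b : WordExp}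
    (hi : i.Evals w h a) (hU : (WordExp.reg base).Evals w h U) (hb : b.Evals w h e)
    (hw : a * U + e < 2 ^ w) : (frontCell i b).Evals w h (a * U + e) :=
  .add (.mul hi hU rfl) hb rfl

/-- Compute the front of the next round on block `frontBlock`. -/
def blockBody : Prog :=
  pos ::= .max (.max (get 4 (.frontCell (reg roundIndex) (reg frontBlock - 1)))
    (get 4 (.frontCell (reg roundIndex) (reg frontBlock))))
    (get 4 (.frontCell (reg roundIndex) (reg frontBlock + 1))) ;;
  scan ;;
  pos ::= reg pos + reg jumpLength + 1 ;;
  put 4 (.frontCell (reg roundIndex + 1) (reg frontBlock)) (reg pos) ;;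
  best ::= .max (reg best) (reg pos) ;;
  frontBlock ::= reg frontBlock - 1

/-- Compute the fronts of the next round. -/
def roundBody : Prog :=
  frontBlock ::= reg blocks ;;
  .while frontBlock blockBody ;;
  roundIndex ::= reg roundIndex + 1 ;;
  roundsLeft ::= reg roundsLeft - 1

/-- Answer `1` if the whole strings have equal codes or if some front reaches the end. -/
def decideAnswer : Prog :=
  size ::= .max (.op .eq (get 2 0) (get 3 0)) (.op .lt (reg size) (reg best + 1))

/-- The query. -/
def query : Prog :=
  base ::= get 2 2 ;;
  levels ::= get 2 1 ;;
  blocks ::= 2 * reg bound / reg block + 1 ;;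
  roundsLeft ::= reg bound ;;
  .while roundsLeft roundBody ;;
  decideAnswer

theorem query_deterministic : query.Deterministic := by
  simp [query, roundBody, blockBody, scan, scanBody, decideAnswer, Prog.Deterministic,
    assign_deterministic, put_deterministic]

/-- The number of blocks of diagonals that are searched. -/
def numBlocks (k l : ℕ) : ℕ := 2 * k / l + 1

/-- The fronts that the query computes. -/
noncomputable def queryFront (n k l : ℕ) (H H' : ℕ → ℕ → ℕ) : ℕ → ℕ → ℕ :=
  front (Hit n k l H H') (numBlocks k l) (Nat.log 2 n + 1)

theorem queryFront_le {n k l : ℕ} {H H' : ℕ → ℕ → ℕ} (i b : ℕ) :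
    queryFront n k l H H' i b ≤ n + i :=
  front_le (fun _ _ _ h => h.1) i b

theorem queryFront_zero {n k l : ℕ} {H H' : ℕ → ℕ → ℕ} (b : ℕ) : queryFront n k l H H' 0 b = 0 :=
  rfl

theorem queryFront_of_not {n k l i b : ℕ} {H H' : ℕ → ℕ → ℕ} (hb : ¬(1 ≤ b ∧ b ≤ numBlocks k l)) :
    queryFront n k l H H' i b = 0 :=
  front_of_not hb

theorem queryFront_succ {n k l i b : ℕ} {H H' : ℕ → ℕ → ℕ} (hb : 1 ≤ b) (hb' : b ≤ numBlocks k l) :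
    queryFront n k l H H' (i + 1) b = bestNeighbor (queryFront n k l H H' i) b +
      jump (Hit n k l H H' · (bestNeighbor (queryFront n k l H H' i) b) b) (Nat.log 2 n + 1) + 1 :=
  front_succ hb hb'

/-- The criterion for the answer `1`: the codes `v`, `v'` of the whole strings agree, or some front
reaches the end of the first string. -/
def Accepts (n k l : ℕ) (H H' : ℕ → ℕ → ℕ) (v v' : ℕ) : Prop :=
  v = v' ∨ ∃ i ≤ k, ∃ b ≤ numBlocks k l, n ≤ queryFront n k l H H' i b

/-- While round `i + 1` is under way, the front of round `i'` on block `b` is known if the blocks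
above `b₀` are done. -/
def Known (i b₀ i' b : ℕ) : Prop := i' ≤ i ∨ i' = i + 1 ∧ b₀ < b

open Classical in
/-- The array `a` holds the known fronts on `nb` blocks, and `r` is the farthest one. -/
structure FrontTable (nb U : ℕ) (F : ℕ → ℕ → ℕ) (i b₀ : ℕ) (a : ℕ → ℕ) (r : ℕ) : Prop where
  front : ∀ i' b, b ≤ nb + 1 → a (i' * U + b) = if Known i b₀ i' b then F i' b else 0
  exists_eq : ∃ i' b, Known i b₀ i' b ∧ b ≤ nb ∧ r = F i' b
  le : ∀ i' b, Known i b₀ i' b → b ≤ nb → F i' b ≤ r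

namespace FrontTable

variable {nb U i b r n : ℕ} {F : ℕ → ℕ → ℕ} {a : ℕ → ℕ}

theorem init (hF₀ : ∀ b, F 0 b = 0) (hF : ∀ i b, ¬(1 ≤ b ∧ b ≤ nb) → F i b = 0) :
    FrontTable nb U F 0 nb (fun _ => 0) 0 where
  front i' b _ := by
    split_ifs with h
    · rcases h with h | ⟨-, h⟩
      · rw [Nat.le_zero.1 h, hF₀]
      · rw [hF _ _ (by omega)]
    · rfl
  exists_eq := ⟨0, 0, .inl le_rfl, Nat.zero_le _, (hF₀ 0).symm⟩
  le i' b h hb := by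
    obtain rfl : i' = 0 := by unfold Known at h; omega
    exact (hF₀ b).le

theorem front_of_le (h : FrontTable nb U F i b a r) {b' : ℕ} (hb' : b' ≤ nb + 1) :
    a (i * U + b') = F i b' := by
  rw [h.front i b' hb', if_pos (.inl le_rfl)]

theorem le_add_succ (h : FrontTable nb U F i b a r) (hF : ∀ i b, F i b ≤ n + i) :
    r ≤ n + (i + 1) := by
  obtain ⟨i', b', hk, -, rfl⟩ := h.exists_eq
  have := hF i' b'
  unfold Known at hk
  omega

theorem known_succ_iff (i' b' : ℕ) :
    Known i b i' b' ↔ Known i (b + 1) i' b' ∨ i' = i + 1 ∧ b' = b + 1 := by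
  unfold Known
  omega

open Classical in
theorem insert (h : FrontTable nb U F i (b + 1) a r) (hb : b < nb) (hU : nb + 1 < U) :
    FrontTable nb U F i b
      (Function.update a ((i + 1) * U + (b + 1)) (F (i + 1) (b + 1)))
      (max r (F (i + 1) (b + 1))) where
  front i' b' hb' := by
    rw [Function.update_apply]
    by_cases hnew : i' = i + 1 ∧ b' = b + 1
    · obtain ⟨rfl, rfl⟩ := hnew
      rw [if_pos rfl, if_pos ((known_succ_iff _ _).2 (.inr ⟨rfl, rfl⟩))]
    · rw [if_neg fun e => hnew (mul_add_inj_of_lt (by omega) (by omega) e), h.front _ _ hb']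
      exact if_congr ((known_succ_iff i' b').trans (or_iff_left hnew)).symm rfl rfl
  exists_eq := by
    obtain ⟨i', b', hk, hb', hr⟩ := h.exists_eq
    rcases max_choice r (F (i + 1) (b + 1)) with hmax | hmax <;> rw [hmax]
    · exact ⟨i', b', (known_succ_iff _ _).2 (.inl hk), hb', hr⟩
    · exact ⟨i + 1, b + 1, (known_succ_iff _ _).2 (.inr ⟨rfl, rfl⟩), hb, rfl⟩
  le i' b' hk hb' := by
    rcases (known_succ_iff _ _).1 hk with hk | ⟨rfl, rfl⟩
    · exact (h.le _ _ hk hb').trans (le_max_left ..)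
    · exact le_max_right ..

open Classical in
theorem next_round (h : FrontTable nb U F i 0 a r)
    (hF : ∀ i b, ¬(1 ≤ b ∧ b ≤ nb) → F i b = 0) : FrontTable nb U F (i + 1) nb a r where
  front i' b hb := by
    rw [h.front i' b hb]
    by_cases hb' : 1 ≤ b ∧ b ≤ nb
    · exact if_congr (by unfold Known; omega) rfl rfl
    · simp only [hF i' b hb', ite_self]
  exists_eq := by
    obtain ⟨i', b', hk, hb', hr⟩ := h.exists_eq
    exact ⟨i', b', by unfold Known at *; omega, hb', hr⟩
  le i' b hk hb := by
    rcases Nat.eq_zero_or_pos b with rfl | hb'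
    · rw [hF i' 0 (by omega)]
      exact Nat.zero_le r
    · exact h.le i' b (by unfold Known at *; omega) hb

theorem le_iff_exists (h : FrontTable nb U F i nb a r) {m : ℕ} :
    m ≤ r ↔ ∃ i' ≤ i, ∃ b ≤ nb, m ≤ F i' b := by
  constructor
  · intro hm
    obtain ⟨i', b, hk, hb, rfl⟩ := h.exists_eq
    exact ⟨i', by unfold Known at hk; omega, b, hb, hm⟩
  · rintro ⟨i', hi, b, hb, hm⟩
    exact hm.trans (h.le i' b (.inl hi) hb)

end FrontTable

/-- The registers and arrays that stay fixed during the rounds of the query. -/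
structure QueryBase (n k l U : ℕ) (E E' : ℕ → ℕ) (h : Config) : Prop where
  size : h.reg size = n
  block : h.reg block = l
  base : h.reg base = U
  blocks : h.reg blocks = numBlocks k l
  levels : h.reg levels = Nat.log 2 n + 1
  table : h.mem 2 = E
  table' : h.mem 3 = E'

/-- The state of the query when `c` further rounds are to be made after round `i + 1`, in which the
blocks above `b₀` are done. -/
structure RoundState (n k l U : ℕ) (E E' : ℕ → ℕ) (F : ℕ → ℕ → ℕ) (i b₀ c : ℕ) (h : Config) : Prop
    extends QueryBase n k l U E E' h where
  round : h.reg roundIndex = i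
  left : h.reg roundsLeft = c
  fronts : FrontTable (numBlocks k l) U F i b₀ (h.mem 4) (h.reg best)

/-- The state of the loop over the blocks. -/
structure BlockState (n k l U : ℕ) (E E' : ℕ → ℕ) (F : ℕ → ℕ → ℕ) (i b₀ c : ℕ) (h : Config) : Prop
    extends RoundState n k l U E E' F i b₀ c h where
  frontBlock : h.reg frontBlock = b₀

/-- The state of the scan of the levels from position `m` on block `b₀`, when the levels below `j`
are done. -/
structure ScanState (n k l U : ℕ) (H H' : ℕ → ℕ → ℕ) (E E' : ℕ → ℕ) (F : ℕ → ℕ → ℕ)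
    (i b₀ c m j : ℕ) (h : Config) : Prop extends BlockState n k l U E E' F i b₀ c h where
  position : h.reg pos = m
  jumpLength : h.reg jumpLength = jump (Hit n k l H H' · m b₀) j
  level : h.reg level = j
  width : h.reg width = 2 ^ j

theorem jump_succ_eq_max {hit : ℕ → Prop} {c j : ℕ} (h : 0 < c ↔ hit j) :
    jump hit (j + 1) = max (jump hit j) ((if 0 < c then 1 else 0) * 2 ^ j) := by
  by_cases hj : hit j
  · rw [jump_succ_of_hit hj, if_pos (h.2 hj), one_mul]
  · rw [jump_succ_of_not_hit hj, if_neg (mt h.1 hj), zero_mul, max_eq_left (Nat.zero_le _)]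

theorem jump_hit_le {n k l m b j : ℕ} {H H' : ℕ → ℕ → ℕ} : jump (Hit n k l H H' · m b) j ≤ n := by
  rcases jump_eq_zero_or (Hit n k l H H' · m b) j with h | ⟨j', hit, h⟩
  · exact h.trans_le (Nat.zero_le n)
  · exact h.trans_le (le_add_self.trans hit.1)

theorem Sizes.numBlocks_le {w n k l σ U D : ℕ} (S : Sizes w n k l σ U D) :
    numBlocks k l ≤ 2 * n + 1 := by
  have := S.bound_le
  have := Nat.div_le_self (2 * k) l
  unfold numBlocks
  omega

section Execution

variable {w n k l σ U D K : ℕ} {ω : Tape w} {H H' : ℕ → ℕ → ℕ} {E E' : ℕ → ℕ} {F : ℕ → ℕ → ℕ}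
  {i c : ℕ} {h : Config}

theorem IsOutput.evals_mark (hE' : IsOutput U K l n H' E') (S : Sizes w n k l σ U D)
    {e₁ e₂ e₃ : WordExp} {j β v : ℕ} (htable : h.mem 3 = E') (hbase : h.reg Register.base = U)
    (hj : e₁.Evals w h j) (hβ : e₂.Evals w h β) (hv : e₃.Evals w h v) (hj' : j < U) (hβ₁ : 1 ≤ β)
    (hβ' : β < U) (hv' : v + 2 ≤ U) :
    (get 3 (.cell e₁ e₂ e₃)).Evals w h (E' (cell U j β v)) := by
  obtain ⟨-, -, -, -, hUw⟩ := S.bounds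
  have := hE'.mark_le_one (j := j) hβ₁ hβ' (c := v) (by omega)
  exact .get (.cell hbase S.pow_lt hj hβ hv hj' hβ' (by omega)) (congrFun htable _) (by omega)

theorem haltsWithin_scanBody (S : Sizes w n k l σ U D) (hE : IsOutput U (k + l) l n H E)
    (hE' : IsOutput U (k + l) l n H' E') {b m j s : ℕ} (hj : j ≤ Nat.log 2 n) (hm : m ≤ 2 * n)
    (hb : 1 ≤ b) (hb' : b ≤ numBlocks k l) (hs : ScanState n k l U H H' E E' F i b c m j h)
    (hleft : h.reg scanLeft = s + 1) (hsn : s ≤ n) :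
    HaltsWithin ω scanBody h 150 fun h' =>
      h'.reg scanLeft = s ∧ ScanState n k l U H H' E E' F i b c m (j + 1) h' := by
  obtain ⟨hl, hlk, hkn, hU, hUw⟩ := S.bounds
  have hnb := S.numBlocks_le
  have hlog : Nat.log 2 n < n := Nat.log_lt_self _ (by omega)
  have hpow : 2 ^ j ≤ n :=
    (Nat.pow_le_pow_right two_pos hj).trans (Nat.pow_log_le_self 2 (by omega))
  have hml := Nat.div_le_self m l
  have hml₀ := Nat.zero_le (m / l)
  have hjump := hs.jumpLength
  have hjump_le : h.reg jumpLength ≤ n := hjump.trans_le jump_hit_le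
  set v := E (cell U j m (U - 1)) with hv
  have hvU : v + 2 ≤ U := hE.entry_add_two_le (by omega)
  have hhit := hE.marks_pos_iff_hit hE' hj (m := m) (b := b) (by omega) hb (by omega)
  rw [← hv] at hhit
  have hmark_le : ∀ β, 1 ≤ β → β < U → E' (cell U j β v) ≤ 1 := fun β hβ hβ' =>
    hE'.mark_le_one hβ hβ' (by omega)
  have hd := hmark_le (m / l + b) (by omega) (by omega)
  have hd' := hmark_le (m / l + (b + 1)) (by omega) (by omega)
  set d := E' (cell U j (m / l + b) v)
  set d' := E' (cell U j (m / l + (b + 1)) v)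
  refine .of_le (by decide) <| .assign_seq (v := v)
    (.get (.entry hs.base S.pow_lt (.reg hs.level) (.reg hs.position) (by omega) (by omega))
      (by rw [hs.table]) (by omega)) <| .assign_seq (v := d + d') (.add (u := d) (v := d')
      (hE'.evals_mark S hs.table' hs.base (.reg hs.level)
        (.add (.div (.reg hs.position) (.reg hs.block)) (.reg hs.frontBlock) rfl)
        (.reg rfl) (by omega) (by omega) (by omega) hvU)
      (hE'.evals_mark S hs.table' hs.base (.reg hs.level)
        (.add (.div (.reg hs.position) (.reg hs.block)) (.add (.reg hs.frontBlock) .ofNat rfl) rfl)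
        (.reg rfl) (by omega) (by omega) (by omega) hvU) rfl) <|
    .assign_seq (.max (.reg (v := h.reg jumpLength) rfl) (.mul
      (.compareLT .ofNat (.reg (v := d + d') rfl) S.wordLength_pos) (.reg hs.width) rfl
      (by split_ifs <;> omega))) <|
    .assign_seq (v := j + 1) (.add (.reg hs.level) .ofNat rfl) <| .assign_seq (v := 2 ^ (j + 1))
    (.mul .ofNat (.reg hs.width) (by ring)) <| .assign (v := s)
    (.sub (.reg hleft) .ofNat rfl) ⟨rfl, { hs with level := rfl, width := rfl, jumpLength := ?_ }⟩
  exact (hjump ▸ jump_succ_eq_max (hit := (Hit n k l H H' · m b)) hhit).symm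

theorem haltsWithin_scan (S : Sizes w n k l σ U D) (hE : IsOutput U (k + l) l n H E)
    (hE' : IsOutput U (k + l) l n H' E') {b m : ℕ} (hm : m ≤ 2 * n)
    (hb : 1 ≤ b) (hb' : b ≤ numBlocks k l) (hs : BlockState n k l U E E' F i b c h)
    (hpos : h.reg pos = m) :
    HaltsWithin ω scan h ((Nat.log 2 n + 1) * 151 + 20)
      (ScanState n k l U H H' E E' F i b c m (Nat.log 2 n + 1)) := by
  obtain ⟨hl, hlk, hkn, hU, hUw⟩ := S.bounds
  have hlog : Nat.log 2 n < n := Nat.log_lt_self _ (by omega)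
  let Inv (s : ℕ) (h : Config) : Prop := ∃ j, j + s = Nat.log 2 n + 1 ∧ h.reg scanLeft = s ∧
    ScanState n k l U H H' E E' F i b c m j h
  refine .of_le (T := 3 + (4 + (3 + (3 + ((Nat.log 2 n + 1) * 151 + 1))))) (by omega) <|
    .assign_seq .ofNat <| .assign_seq (.reg hs.levels) <| .assign_seq .ofNat <|
    .assign_seq .ofNat <| (HaltsWithin.loop Inv ?_ ?_ ?_ ⟨0, zero_add _, rfl, ?_⟩).mono le_rfl ?_
  · rintro h ⟨j, -, hleft, -⟩
    exact hleft
  · rintro s h ⟨j, -, hleft, -⟩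
    exact hleft.trans_ne (Nat.succ_ne_zero _)
  · rintro s h ⟨j, hj, hleft, hs⟩
    exact (haltsWithin_scanBody S hE hE' (by omega) hm hb hb' hs hleft (by omega)).mono le_rfl
      fun h' hs' => ⟨j + 1, by omega, hs'⟩
  · exact { hs with position := hpos, jumpLength := rfl, level := rfl, width := rfl }
  · rintro h ⟨j, rfl, -, hs⟩
    exact hs

theorem RoundState.evals_front (S : Sizes w n k l σ U D) {e : WordExp} {b b₀ : ℕ} (hi : i ≤ k)
    (hs : RoundState n k l U E E' (queryFront n k l H H') i b₀ c h) (he : e.Evals w h b)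
    (hb : b ≤ numBlocks k l + 1) :
    (get 4 (.frontCell (reg roundIndex) e)).Evals w h (queryFront n k l H H' i b) := by
  obtain ⟨-, -, hkn, hU, hUw⟩ := S.bounds
  have hnb := S.numBlocks_le
  have hle : queryFront n k l H H' i b ≤ n + i := queryFront_le i b
  have hcell : i * U + b < U * U := mul_add_lt_mul (by omega) (by omega)
  exact .get (.frontCell (.reg hs.round) (.reg hs.base) he (hcell.trans S.mul_self_lt))
    (hs.fronts.front_of_le hb) (by omega)

theorem haltsWithin_blockBody (S : Sizes w n k l σ U D) (hE : IsOutput U (k + l) l n H E)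
    (hE' : IsOutput U (k + l) l n H' E') {b : ℕ} (hi : i + 1 ≤ k) (hb : b + 1 ≤ numBlocks k l)
    (hs : BlockState n k l U E E' (queryFront n k l H H') i (b + 1) c h) :
    HaltsWithin ω blockBody h ((Nat.log 2 n + 1) * 151 + 99)
      (BlockState n k l U E E' (queryFront n k l H H') i b c) := by
  obtain ⟨-, -, hkn, hU, hUw⟩ := S.bounds
  have hnb := S.numBlocks_le
  have hcell : (i + 1) * U + (b + 1) < U * U := mul_add_lt_mul (by omega) (by omega)
  have hUU := S.mul_self_lt
  have hnext_le : queryFront n k l H H' (i + 1) (b + 1) ≤ n + (i + 1) := queryFront_le _ _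
  have hnext : queryFront n k l H H' (i + 1) (b + 1) = _ := queryFront_succ (by omega) hb
  set m := bestNeighbor (queryFront n k l H H' i) (b + 1)
  refine .of_le (T := 41 + ((Nat.log 2 n + 1) * 151 + 20 + (9 + (13 + (10 + 6))))) (by omega) <|
    .assign_seq (v := m)
    (.max (.max
      (hs.evals_front S (b := b) (by omega) (.sub (.reg hs.frontBlock) .ofNat rfl) (by omega))
      (hs.evals_front S (by omega) (.reg hs.frontBlock) (by omega)))
      (hs.evals_front S (by omega) (.add (.reg hs.frontBlock) .ofNat rfl) (by omega))) <|
    .seq (haltsWithin_scan S hE hE' (m := m) (by omega) (Nat.le_add_left 1 b) hb { hs with } rfl)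
      fun h' hs' => ?_
  have hbest : h'.reg best ≤ n + (i + 1) := hs'.fronts.le_add_succ queryFront_le
  refine .assign_seq (v := queryFront n k l H H' (i + 1) (b + 1))
    (.add (.add (.reg hs'.position) (.reg hs'.jumpLength) rfl) .ofNat hnext.symm) <|
    .put_seq (a := (i + 1) * U + (b + 1)) (.frontCell (.add (.reg hs'.round) .ofNat rfl)
      (.reg hs'.base) (.reg hs'.frontBlock) (by omega))
      (.reg (v := queryFront n k l H H' (i + 1) (b + 1)) rfl) <|
    .assign_seq (.max (.reg (v := h'.reg best) rfl)
      (.reg (v := queryFront n k l H H' (i + 1) (b + 1)) rfl)) <|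
    .assign (v := b) (.sub (.reg hs'.frontBlock) .ofNat rfl) ?_
  exact { hs' with fronts := hs'.fronts.insert hb (by omega), frontBlock := rfl }

theorem haltsWithin_roundBody (S : Sizes w n k l σ U D) (hE : IsOutput U (k + l) l n H E)
    (hE' : IsOutput U (k + l) l n H' E') (hi : i + 1 ≤ k) (hck : c < k)
    (hs : RoundState n k l U E E' (queryFront n k l H H') i (numBlocks k l) (c + 1) h) :
    HaltsWithin ω roundBody h (numBlocks k l * ((Nat.log 2 n + 1) * 151 + 99 + 1) + 17)
      (RoundState n k l U E E' (queryFront n k l H H') (i + 1) (numBlocks k l) c) := by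
  obtain ⟨-, -, hkn, hU, hUw⟩ := S.bounds
  have hnb := S.numBlocks_le
  let Inv (b : ℕ) (h : Config) : Prop := b ≤ numBlocks k l ∧
    BlockState n k l U E E' (queryFront n k l H H') i b (c + 1) h
  refine .of_le (T := 4 + (numBlocks k l * ((Nat.log 2 n + 1) * 151 + 99 + 1) + 1 + (6 + 6)))
    (by omega) <| .assign_seq (.reg hs.blocks) <| .seq (.loop Inv (fun _ hs => hs.2.frontBlock)
      (fun _ _ hs => hs.2.frontBlock.trans_ne (Nat.succ_ne_zero _)) (fun b _ hs =>
        (haltsWithin_blockBody S hE hE' hi hs.1 hs.2).mono le_rfl fun _ hs' => ⟨by omega, hs'⟩)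
      ⟨le_rfl, { hs with frontBlock := rfl }⟩) fun h' ⟨_, hs'⟩ =>
    .assign_seq (v := i + 1) (.add (.reg hs'.round) .ofNat rfl) <|
    .assign (v := c) (.sub (.reg hs'.left) .ofNat rfl) ?_
  exact { hs' with
    round := rfl, left := rfl
    fronts := hs'.fronts.next_round fun _ _ hb => queryFront_of_not hb }

open Classical in
theorem haltsWithin_decideAnswer (S : Sizes w n k l σ U D) {Q : Config → Prop}
    (h₀ : E 0 < 2 ^ w) (h₀' : E' 0 < 2 ^ w)
    (hs : RoundState n k l U E E' (queryFront n k l H H') k (numBlocks k l) c h)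
    (hQ : Q (h.setReg 0 (if Accepts n k l H H' (E 0) (E' 0) then 1 else 0))) :
    HaltsWithin ω decideAnswer h 18 Q := by
  obtain ⟨-, -, hkn, hU, hUw⟩ := S.bounds
  have hbest : h.reg best ≤ n + (k + 1) := hs.fronts.le_add_succ queryFront_le
  have hanswer : max (if E 0 = E' 0 then 1 else 0) (if n < h.reg best + 1 then 1 else 0) =
      if Accepts n k l H H' (E 0) (E' 0) then 1 else 0 := by
    have haccepts : Accepts n k l H H' (E 0) (E' 0) ↔ E 0 = E' 0 ∨ n ≤ h.reg best :=
      or_congr_right hs.fronts.le_iff_exists.symm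
    rw [if_congr haccepts rfl rfl]
    split_ifs <;> omega
  exact .of_le (by decide) <| .assign (hanswer ▸ .max
    (.compareEq (.get .ofNat (by rw [hs.table]) h₀) (.get .ofNat (by rw [hs.table']) h₀')
      S.wordLength_pos)
    (.compareLT (.reg hs.size) (.add (.reg rfl) .ofNat rfl) S.wordLength_pos)) hQ

open Classical in
theorem haltsWithin_query (S : Sizes w n k l σ U D) (hE : IsOutput U (k + l) l n H E)
    (hE' : IsOutput U (k + l) l n H' E') (A B : Fin n → Fin σ) :
    HaltsWithin ω query (queryInit k l A B E E')
      (k * (numBlocks k l * ((Nat.log 2 n + 1) * 151 + 99 + 1) + 17 + 1) + 42)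
      fun h => h.reg 0 = if Accepts n k l H H' (E 0) (E' 0) then 1 else 0 := by
  obtain ⟨hl, hlk, hkn, hU, hUw⟩ := S.bounds
  have hnb := S.numBlocks_le
  have hlog : Nat.log 2 n < n := Nat.log_lt_self _ (by omega)
  let Inv (c : ℕ) (h : Config) : Prop := ∃ i, i + c = k ∧
    RoundState n k l U E E' (queryFront n k l H H') i (numBlocks k l) c h
  refine .of_le (T := 4 + (4 + (11 + (4 +
      (k * (numBlocks k l * ((Nat.log 2 n + 1) * 151 + 99 + 1) + 17 + 1) + 1 + 18))))) (by omega) <|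
    .assign_seq (.get .ofNat hE.base (by omega)) <|
    .assign_seq (.get .ofNat hE.levels (by omega)) <|
    .assign_seq (v := numBlocks k l) (.add (u := 2 * k / l) (.div (u := 2 * k) (v := l)
      (.mul (v := k) .ofNat (.reg rfl) rfl) (.reg rfl)) .ofNat rfl) <|
    .assign_seq (v := k) (.reg rfl) <| .seq (.loop Inv ?_ ?_ ?_ ⟨0, zero_add k, ?_⟩) ?_
  · rintro h ⟨i, -, hs⟩
    exact hs.left
  · rintro c h ⟨i, -, hs⟩
    exact hs.left.trans_ne (Nat.succ_ne_zero _)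
  · rintro c h ⟨i, hi, hs⟩
    exact (haltsWithin_roundBody S hE hE' (by omega) (by omega) hs).mono le_rfl fun h' hs' =>
      ⟨i + 1, by omega, hs'⟩
  · exact ⟨⟨rfl, rfl, rfl, rfl, rfl, rfl, rfl⟩, rfl, rfl,
      .init queryFront_zero fun _ _ => queryFront_of_not⟩
  · rintro h ⟨i, rfl, hs⟩
    exact haltsWithin_decideAnswer S (hE.whole_lt S) (hE'.whole_lt S) hs rfl

open Classical in
theorem exec_query (S : Sizes w n k l σ U D) (hE : IsOutput U (k + l) l n H E)
    (hE' : IsOutput U (k + l) l n H' E') (ω : Tape w) (A B : Fin n → Fin σ) :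
    ∃ t s, Exec w ω query (queryInit k l A B E E') t s ∧
      t ≤ k * (numBlocks k l * ((Nat.log 2 n + 1) * 151 + 100) + 18) + 42 ∧
      s.reg 0 = if Accepts n k l H H' (E 0) (E' 0) then 1 else 0 := by
  obtain ⟨t, s, h, he, ht, hs, hout⟩ := haltsWithin_query S hE hE' A B _ .refl
  exact ⟨t, s, he, ht, (hs.reg 0 (by decide)).trans hout⟩

end Execution

/-! ### The choice of the word length -/

section WordLength

variable {n k l σ w : ℕ}

theorem div_div_le_of_mul_self_le {m q : ℕ} (h : q * q ≤ m) : m / (m / q) ≤ q := by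
  rcases Nat.eq_zero_or_pos q with rfl | hq
  · rw [Nat.div_zero, Nat.div_zero]
  have hdiv : q ≤ m / q := (Nat.le_div_iff_mul_le hq).2 h
  have hm := Nat.lt_div_mul_add (a := m) hq
  rw [← Nat.lt_succ_iff, Nat.div_lt_iff_lt_mul (by omega), Nat.succ_mul, mul_comm q]
  omega

theorem tableBase_pow_three_lt (hn : 1 ≤ n) (hσ : 1 ≤ σ) :
    tableBase n σ ^ 3 < 2 ^ wordLength 32 n σ := by
  have hn' : n < 2 ^ Nat.size n := Nat.lt_size_self n
  have hσ' : σ < 2 ^ Nat.size σ := Nat.lt_size_self σ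
  rw [wordLength, mul_comm 32, pow_mul, pow_add]
  have hP : n * σ ≤ 2 ^ Nat.size n * 2 ^ Nat.size σ := Nat.mul_le_mul hn'.le hσ'.le
  have hP4 : 2 * 2 ≤ 2 ^ Nat.size n * 2 ^ Nat.size σ := Nat.mul_le_mul (by omega) (by omega)
  generalize 2 ^ Nat.size n * 2 ^ Nat.size σ = P at *
  have hbase : tableBase n σ ≤ P ^ 9 := by
    calc (4 * (n * σ)) ^ 4 + 4 ≤ (P * P) ^ 4 + (P * P) ^ 4 := by
          refine add_le_add (Nat.pow_le_pow_left (Nat.mul_le_mul hP4 hP) 4) ?_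
          exact (Nat.mul_le_mul hP4 hP4).trans' (by norm_num) |>.trans
            (Nat.le_self_pow (by norm_num) _)
      _ = P ^ 8 * 2 := by ring
      _ ≤ P ^ 8 * P := by gcongr; omega
      _ = P ^ 9 := (pow_succ P 8).symm
  calc tableBase n σ ^ 3 ≤ (P ^ 9) ^ 3 := Nat.pow_le_pow_left hbase 3
    _ = P ^ 27 := (pow_mul P 9 3).symm
    _ < P ^ 32 := Nat.pow_lt_pow_right (by omega) (by norm_num)

theorem sizes_of_tableBase_pow_three_lt (hl : 1 ≤ l) (hlk : l ≤ k) (hkn : k ≤ n) (hσ : 1 ≤ σ)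
    (h : tableBase n σ ^ 3 < 2 ^ w) : Sizes w n k l σ (tableBase n σ) (hashDiv w n σ) := by
  have hn : n ≤ n * σ := Nat.le_mul_of_pos_right n hσ
  have hσn : σ ≤ n * σ := Nat.le_mul_of_pos_left σ (by omega)
  rw [tableBase, hashDiv] at *
  have hQ : 64 * (4 * (n * σ)) ≤ (4 * (n * σ)) ^ 4 := by
    calc 64 * (4 * (n * σ)) = 4 ^ 3 * (4 * (n * σ)) := rfl
      _ ≤ (4 * (n * σ)) ^ 3 * (4 * (n * σ)) := by gcongr; omega
      _ = (4 * (n * σ)) ^ 4 := (pow_succ _ 3).symm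
  generalize (4 * (n * σ)) ^ 4 = Q at *
  have hQQ : Q * Q ≤ 2 ^ w - 1 := by
    have : Q * Q ≤ (Q + 4) ^ 3 := by nlinarith
    omega
  have hQW : Q ≤ 2 ^ w - 1 := (Nat.le_mul_self Q).trans hQQ
  exact {
    one_le := hl
    block_le := hlk
    bound_le := hkn
    size_le := by omega
    alphabet_le := by omega
    pow_lt := h
    divisor_pos := Nat.div_pos hQW (by omega)
    divisor_lt := (Nat.div_le_self _ _).trans_lt (by omega)
    hash_le := by
      have := div_div_le_of_mul_self_le hQQ
      omega }

theorem sizes_wordLength (hl : 1 ≤ l) (hlk : l ≤ k) (hkn : k ≤ n) (hσ : 1 ≤ σ) :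
    Sizes (wordLength 32 n σ) n k l σ (tableBase n σ) (hashDiv (wordLength 32 n σ) n σ) :=
  sizes_of_tableBase_pow_three_lt hl hlk hkn hσ (tableBase_pow_three_lt (by omega) hσ)

theorem collisionBound_mul_le (hσ : 1 ≤ σ) (h : tableBase n σ ^ 3 < 2 ^ w) :
    Nat.log 2 n * n * n * (4 * hashDiv w n σ + 2 * (tableBase n σ * tableBase n σ)) * n ≤
      2 ^ w := by
  have hlog : Nat.log 2 n ≤ n := Nat.log_le_self _ _
  have hQ : 256 * n ^ 4 ≤ (4 * (n * σ)) ^ 4 := by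
    calc 256 * n ^ 4 = (4 * (n * 1)) ^ 4 := by ring
      _ ≤ _ := by gcongr
  have hD : (4 * (n * σ)) ^ 4 * hashDiv w n σ ≤ 2 ^ w :=
    (Nat.mul_div_le _ _).trans (Nat.sub_le _ _)
  have hU : (4 * (n * σ)) ^ 4 ≤ tableBase n σ := Nat.le_add_right _ _
  have hDn : 256 * n ^ 4 * hashDiv w n σ ≤ 2 ^ w := (Nat.mul_le_mul_right _ hQ).trans hD
  have hUn : 256 * n ^ 4 * (tableBase n σ * tableBase n σ) ≤ 2 ^ w := by
    calc 256 * n ^ 4 * (tableBase n σ * tableBase n σ)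
        ≤ tableBase n σ * (tableBase n σ * tableBase n σ) := by gcongr; exact hQ.trans hU
      _ = tableBase n σ ^ 3 := by ring
      _ ≤ 2 ^ w := h.le
  calc Nat.log 2 n * n * n * (4 * hashDiv w n σ + 2 * (tableBase n σ * tableBase n σ)) * n
      ≤ n * n * n * (4 * hashDiv w n σ + 2 * (tableBase n σ * tableBase n σ)) * n := by gcongr
    _ = 4 * (n ^ 4 * hashDiv w n σ) + 2 * (n ^ 4 * (tableBase n σ * tableBase n σ)) := by ring
    _ ≤ 2 ^ w := by
      rw [mul_assoc] at hDn hUn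
      omega

end WordLength

/-! ### Correctness of the query -/

section Hit

variable {n k l σ : ℕ} {A B : Fin n → Fin σ}

theorem getElem?_ofFn_eq_iff {x y : ℕ} (hx : x < n) (hy : y < n) :
    (List.ofFn A)[x]? = (List.ofFn B)[y]? ↔ stringArray A x = stringArray B y := by
  simp [stringArray, hx, hy, Fin.ext_iff]

theorem eq_of_stringArray_eq (h : ∀ x < n, stringArray A x = stringArray B x) : A = B := by
  funext x
  simpa [stringArray, Fin.ext_iff] using h x x.2

theorem matchAt_ofFn_iff {x y r : ℕ} (hx : x + r ≤ n) (hy : y + r ≤ n) :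
    MatchAt (List.ofFn A) (List.ofFn B) x y r ↔
      ∀ t < r, stringArray A (x + t) = stringArray B (y + t) :=
  forall₂_congr fun _ _ => getElem?_ofFn_eq_iff (by omega) (by omega)

theorem editDist_le_of_le_front {nb L i b : ℕ} {hit : ℕ → ℕ → ℕ → Prop} (hl : 0 < l) (hlk : l ≤ k)
    (hnb : nb * l ≤ 2 * k + l) (hh : HitSound (List.ofFn A) (List.ofFn B) (k + l) l hit)
    (hi : i ≤ k) (hb : b ≤ nb) (hn : n ≤ front hit nb L i b) : editDist A B ≤ 12 * k * l := by
  have hbl : b * l ≤ nb * l := Nat.mul_le_mul_right l hb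
  have hfront := prefixED_front (nb := nb) (L := L) (k := k) hl (by omega) hh i (β := b) (by omega)
  generalize front hit nb L i b = x at *
  obtain ⟨d, hd, hs⟩ := hfront.move_right (y' := x + b * l) le_rfl
  rw [List.take_of_length_le (by simpa using hn),
    List.take_of_length_le (by rw [List.length_ofFn]; exact hn.trans (Nat.le_add_right _ _))] at hs
  refine (editDist_le hs).trans (hd.trans ?_)
  have hil : l * i ≤ l * k := Nat.mul_le_mul_left l hi
  have hkl : k ≤ l * k := Nat.le_mul_of_pos_left k hl
  rw [mul_assoc 8, mul_assoc, mul_comm k]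
  omega

variable {w : ℕ} {ω : Tape w}

theorem hitComplete_stringFingerprint {L : ℕ} :
    HitComplete (List.ofFn A) (List.ofFn B) (k + l) l L
      (Hit n k l (stringFingerprint ω A) (stringFingerprint ω B)) := by
  intro j m y β _ hm hy hmatch hnear
  rw [List.length_ofFn] at hm hy
  exact ⟨hm, y, hy, hnear, (fingerprint_congr ((matchAt_ofFn_iff hm hy).1 hmatch)).symm⟩

/-- No two windows of the two strings collide under the hash functions that the tape provides. -/
def CollisionFree (ω : Tape w) (A B : Fin n → Fin σ) : Prop :=
  ∀ i < Nat.log 2 n, ∀ x < n, ∀ y < n, ¬Collide (2 ^ w) (tableBase n σ) (hashDiv w n σ)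
    (tapeWords ω) (stringArray A) (stringArray B) i x y

theorem Sizes.stringFingerprint_lt (S : Sizes w n k l σ (tableBase n σ) (hashDiv w n σ))
    (ω : Tape w) (A : Fin n → Fin σ) (j x : ℕ) : stringFingerprint ω A j x < tableBase n σ := by
  have := S.fingerprint_add_two_le (stringArray_le A) (tapeWords ω) j x
  rw [stringFingerprint]
  omega

namespace CollisionFree

theorem matchAt (hc : CollisionFree ω A B)
    (S : Sizes w n k l σ (tableBase n σ) (hashDiv w n σ)) {j x y : ℕ} (hx : x + 2 ^ j ≤ n)
    (hy : y + 2 ^ j ≤ n) (h : stringFingerprint ω A j x = stringFingerprint ω B j y) :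
    ∀ t < 2 ^ j, stringArray A (x + t) = stringArray B (y + t) :=
  eq_of_fingerprint_eq (S.stringFingerprint_lt ω A) (S.stringFingerprint_lt ω B) hc
    (Nat.le_log_of_pow_le (by norm_num) (by omega)) hx hy h

theorem hitSound (hc : CollisionFree ω A B)
    (S : Sizes w n k l σ (tableBase n σ) (hashDiv w n σ)) :
    HitSound (List.ofFn A) (List.ofFn B) (k + l) l
      (Hit n k l (stringFingerprint ω A) (stringFingerprint ω B)) := by
  rintro j m β ⟨hm, y, hy, hnear, h⟩
  exact ⟨y, hnear, (matchAt_ofFn_iff hm hy).2 (hc.matchAt S hm hy h.symm)⟩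

theorem eq_of_isOutput (hc : CollisionFree ω A B)
    (S : Sizes w n k l σ (tableBase n σ) (hashDiv w n σ)) {E E' : ℕ → ℕ}
    (hE : IsOutput (tableBase n σ) (k + l) l n (stringFingerprint ω A) E)
    (hE' : IsOutput (tableBase n σ) (k + l) l n (stringFingerprint ω B) E') (h : E 0 = E' 0) :
    A = B := by
  rw [hE.whole, hE'.whole] at h
  obtain ⟨hleft, hright⟩ := mul_add_inj_of_lt (S.stringFingerprint_lt ω A _ _)
    (S.stringFingerprint_lt ω B _ _) h
  obtain ⟨hl, hlk, hkn, -, -⟩ := S.bounds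
  have hle : 2 ^ Nat.log 2 n ≤ n := Nat.pow_log_le_self 2 (by omega)
  have hlt : n < 2 ^ Nat.log 2 n * 2 := Nat.lt_pow_succ_log_self one_lt_two n
  refine eq_of_stringArray_eq fun x hx => ?_
  obtain hx' | hx' := lt_or_ge x (2 ^ Nat.log 2 n)
  · simpa using hc.matchAt S (x := 0) (y := 0) (by omega) (by omega) hleft x hx'
  · obtain ⟨t, rfl⟩ := Nat.exists_eq_add_of_le (show n - 2 ^ Nat.log 2 n ≤ x by omega)
    exact hc.matchAt S (by omega) (by omega) hright t (by omega)

end CollisionFree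

end Hit

section Answers

variable {w n k l σ : ℕ} {ω : Tape w} {A B : Fin n → Fin σ} {E E' : ℕ → ℕ}

theorem numBlocks_mul_le (k l : ℕ) : numBlocks k l * l ≤ 2 * k + l := by
  rw [numBlocks, Nat.succ_mul]
  exact Nat.add_le_add_right (Nat.div_mul_le_self _ _) _

theorem lt_numBlocks_succ_mul (hl : 0 < l) : 2 * k + l < (numBlocks k l + 1) * l := by
  have := Nat.lt_div_mul_add (a := 2 * k) hl
  rw [numBlocks, add_mul, add_mul]
  omega

theorem PreOut.isOutput (S : Sizes w n k l σ (tableBase n σ) (hashDiv w n σ))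
    (h : PreOut w ω preprocess k l A E) :
    IsOutput (tableBase n σ) (k + l) l n (stringFingerprint ω A) E := by
  obtain ⟨t, s, he, rfl⟩ := h
  obtain ⟨t', s', he', -, hout⟩ := exec_preprocess S ω A
  rw [(he.unique he').2]
  exact hout

open Classical in
theorem exists_isOutput_answers (S : Sizes w n k l σ (tableBase n σ) (hashDiv w n σ)) (ω : Tape w)
    (A B : Fin n → Fin σ) :
    ∃ E E', IsOutput (tableBase n σ) (k + l) l n (stringFingerprint ω A) E ∧
      IsOutput (tableBase n σ) (k + l) l n (stringFingerprint ω B) E' ∧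
      Answers w ω preprocess query k l A B
        (if Accepts n k l (stringFingerprint ω A) (stringFingerprint ω B) (E 0) (E' 0)
          then 1 else 0) := by
  obtain ⟨t, s, he, -, hE⟩ := exec_preprocess S ω A
  obtain ⟨t', s', he', -, hE'⟩ := exec_preprocess S ω B
  obtain ⟨t₁, s₁, hq, -, hans⟩ := exec_query S hE hE' ω A B
  exact ⟨_, _, hE, hE', _, _, t₁, s₁, ⟨_, _, he, rfl⟩, ⟨_, _, he', rfl⟩, hq, hans⟩

theorem exists_le_queryFront (hl : 0 < l) (hd : 0 < editDist A B)
    (h : 3 * editDist A B * (Nat.log 2 n + 1) ≤ k) :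
    ∃ i ≤ k, ∃ b ≤ numBlocks k l,
      n ≤ queryFront n k l (stringFingerprint ω A) (stringFingerprint ω B) i b := by
  have hrounds : editDist A B * (Nat.log 2 n + 1 + 1) + (Nat.log 2 n + 1) ≤ k := by nlinarith
  have hdk : editDist A B ≤ k := by nlinarith
  have hscript : EditScript ((List.ofFn A).drop 0) ((List.ofFn B).drop 0) (editDist A B) :=
    editScript_editDist A B
  obtain ⟨β, hβ⟩ := exists_onBlock (K := k + l) (p := 0) (q := 0) hl (Nat.zero_le _)
  obtain ⟨b, -, hb, hfront⟩ := exists_length_le_front hl (lt_numBlocks_succ_mul hl)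
    (by rw [List.length_ofFn]; exact Nat.lt_pow_succ_log_self (by norm_num) n)
    (hitComplete_stringFingerprint (ω := ω)) hscript (Nat.zero_le _) (Nat.zero_le _)
    (by omega) (by omega) hβ (i := 0) (Nat.zero_le _)
  rw [List.length_ofFn, zero_add] at hfront
  exact ⟨_, hrounds, b, hb, hfront⟩

theorem eq_of_editDist_eq_zero (h : editDist A B = 0) : A = B := by
  obtain heq | ⟨_, _, _, _, _, _, hd, -⟩ := (editScript_editDist A B).eq_or_exists_edit
  · exact List.ofFn_injective heq
  · omega

theorem answers_one (S : Sizes w n k l σ (tableBase n σ) (hashDiv w n σ)) (ω : Tape w)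
    (h : 3 * editDist A B * (Nat.log 2 n + 1) ≤ k) :
    Answers w ω preprocess query k l A B 1 := by
  obtain ⟨E, E', hE, hE', hans⟩ := exists_isOutput_answers S ω A B
  rwa [if_pos] at hans
  obtain hd | hd := Nat.eq_zero_or_pos (editDist A B)
  · obtain rfl := eq_of_editDist_eq_zero hd
    exact .inl (by rw [hE.whole, hE'.whole])
  · exact .inr (exists_le_queryFront S.one_le hd h)

theorem CollisionFree.answers_zero (hc : CollisionFree ω A B)
    (S : Sizes w n k l σ (tableBase n σ) (hashDiv w n σ)) (h : 12 * k * l < editDist A B) :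
    Answers w ω preprocess query k l A B 0 := by
  obtain ⟨E, E', hE, hE', hans⟩ := exists_isOutput_answers S ω A B
  rwa [if_neg] at hans
  refine fun haccept => h.not_ge ?_
  obtain hcode | ⟨i, hi, b, hb, hn⟩ := haccept
  · obtain rfl := hc.eq_of_isOutput S hE hE' hcode
    exact (editDist_le (.refl _)).trans (Nat.zero_le _)
  · exact editDist_le_of_le_front S.one_le S.block_le (numBlocks_mul_le k l) (hc.hitSound S) hi hb
      hn

end Answers

/-! ### Running times and probabilities -/

theorem le_polylog {C : ℕ} (hC : C ≠ 0) (n : ℕ) : C * (Nat.log 2 n + 1) ≤ polylog C n :=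
  Nat.mul_le_mul_left C (Nat.le_self_pow hC _)

theorem runTime_le_of_exec {w : ℕ} {ω : Tape w} {p : Prog} {s s' : Config} {t : ℕ}
    (h : Exec w ω p s t s') : runTime w ω p s ≤ t :=
  iInf_le_of_le t (iInf_le_of_le s' (iInf_le _ h))

instance isProbabilityMeasure_tapeLaw (w : ℕ) : IsProbabilityMeasure (tapeLaw w) := by
  unfold tapeLaw
  infer_instance

section Bounds

variable {w n k l σ : ℕ} (S : Sizes w n k l σ (tableBase n σ) (hashDiv w n σ))

include S

theorem lintegral_runTime_preprocess_le (A : Fin n → Fin σ) :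
    ∫⁻ ω, runTime w ω preprocess (preInit k l A) ∂(tapeLaw w) ≤
      (polylog 2000 n : ℝ≥0∞) * n * k / l := by
  obtain ⟨hl, hlk, -, -, -⟩ := S.bounds
  have hl0 : (l : ℝ≥0∞) ≠ 0 := by exact_mod_cast Nat.ne_of_gt hl
  have hpolylog := le_polylog (C := 2000) (by norm_num) n
  have hbound (ω : Tape w) : runTime w ω preprocess (preInit k l A) ≤
      (polylog 2000 n : ℝ≥0∞) * n * k / l := by
    obtain ⟨t, s, he, ht, -⟩ := exec_preprocess S ω A
    refine (runTime_le_of_exec he).trans ?_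
    rw [ENNReal.le_div_iff_mul_le (.inl hl0) (.inl (ENNReal.natCast_ne_top _))]
    have htn : t ≤ polylog 2000 n * n := by
      calc t ≤ 1000 * (Nat.log 2 n + 1) * n := ht.trans_eq (by ring)
        _ ≤ polylog 2000 n * n := Nat.mul_le_mul_right n (by omega)
    exact_mod_cast Nat.mul_le_mul htn hlk
  refine (lintegral_mono hbound).trans_eq ?_
  rw [lintegral_const, measure_univ, mul_one]

theorem queryTime_mul_le :
    (k * (numBlocks k l * ((Nat.log 2 n + 1) * 151 + 100) + 18) + 42) * l ≤
      polylog 2000 n * k ^ 2 := by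
  have hlk := S.block_le
  have hpolylog := le_polylog (C := 2000) (by norm_num) n
  have hblocks : numBlocks k l * l ≤ 3 * k := (numBlocks_mul_le k l).trans (by omega)
  have hlog : 1 ≤ Nat.log 2 n + 1 := Nat.le_add_left 1 _
  generalize Nat.log 2 n + 1 = L at *
  have hlkk : l ≤ k * k := hlk.trans (Nat.le_mul_self k)
  calc (k * (numBlocks k l * (L * 151 + 100) + 18) + 42) * l
      = k * (numBlocks k l * l * (L * 151 + 100)) + 18 * (k * l) * 1 + 42 * l * 1 := by ring
    _ ≤ k * (3 * k * (L * 151 + L * 100)) + 18 * (k * k) * L + 42 * (k * k) * L := by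
        gcongr
        omega
    _ = 813 * L * k ^ 2 := by ring
    _ ≤ polylog 2000 n * k ^ 2 := Nat.mul_le_mul_right _ (by omega)

theorem exec_query_of_preOut {ω : Tape w} {A B : Fin n → Fin σ} {E E' : ℕ → ℕ}
    (hE : PreOut w ω preprocess k l A E) (hE' : PreOut w ω preprocess k l B E') :
    ∃ t s, Exec w ω query (queryInit k l A B E E') t s ∧
      (t : ℝ) ≤ (polylog 2000 n : ℝ) * (k : ℝ) ^ 2 / (l : ℝ) := by
  obtain ⟨t, s, he, ht, -⟩ := exec_query S (hE.isOutput S) (hE'.isOutput S) ω A B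
  refine ⟨t, s, he, ?_⟩
  rw [le_div_iff₀ (by exact_mod_cast S.one_le)]
  exact_mod_cast (Nat.mul_le_mul_right l ht).trans (queryTime_mul_le S)

theorem one_sub_le_tapeLaw_answers_one {A B : Fin n → Fin σ}
    (h : 3 * editDist A B * (Nat.log 2 n + 1) ≤ k) :
    1 - 1 / (n : ℝ≥0∞) ≤ tapeLaw w {ω | Answers w ω preprocess query k l A B 1} := by
  have hall : {ω | Answers w ω preprocess query k l A B 1} = Set.univ :=
    Set.eq_univ_of_forall fun ω => answers_one S ω h
  rw [hall, measure_univ]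
  exact tsub_le_self

theorem tapeLaw_not_collisionFree_le (A B : Fin n → Fin σ) :
    tapeLaw w {ω | ¬CollisionFree ω A B} ≤ 1 / (n : ℝ≥0∞) := by
  obtain ⟨hl, hlk, hkn, -, -⟩ := S.bounds
  have hσ : 1 ≤ σ := (A ⟨0, by omega⟩).pos
  have hn : (n : ℝ≥0∞) ≠ 0 := by exact_mod_cast show n ≠ 0 by omega
  have hcollide := tapeLaw_exists_collide_le (fun ω => S.stringFingerprint_lt ω A)
    (fun ω => S.stringFingerprint_lt ω B) S.divisor_pos (Nat.log 2 n) n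
  simp only [CollisionFree, not_forall, not_not, exists_prop]
  refine hcollide.trans ?_
  rw [ENNReal.le_div_iff_mul_le (.inl hn) (.inl (ENNReal.natCast_ne_top _)),
    ← ENNReal.mul_div_right_comm]
  refine ENNReal.div_le_of_le_mul ?_
  rw [one_mul]
  exact_mod_cast collisionBound_mul_le hσ S.pow_lt

theorem one_sub_le_tapeLaw_answers_zero {A B : Fin n → Fin σ} (h : 12 * k * l < editDist A B) :
    1 - 1 / (n : ℝ≥0∞) ≤ tapeLaw w {ω | Answers w ω preprocess query k l A B 0} := by
  have hsub : {ω | Answers w ω preprocess query k l A B 0}ᶜ ⊆ {ω | ¬CollisionFree ω A B} :=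
    fun ω hω hc => hω (CollisionFree.answers_zero hc S h)
  rw [tsub_le_iff_right]
  calc 1 = tapeLaw w Set.univ := measure_univ.symm
    _ ≤ _ := measure_univ_le_add_compl _
    _ ≤ _ := by gcongr; exact (measure_mono hsub).trans (tapeLaw_not_collisionFree_le S A B)

end Bounds

/-- Gap edit distance with two-sided preprocessing.  Answer `1` means SMALL, `0` means LARGE. -/
theorem mainTheorem5 :
    ∃ (c C : ℕ) (pre query : Prog), 1 ≤ c ∧ 1 ≤ C ∧ query.Deterministic ∧
      ∀ (n k l σ : ℕ), 1 ≤ l → l ≤ k → k ≤ n →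
        -- each string is preprocessed in expected time `Õ(n k / l)`
        (∀ A : Fin n → Fin σ,
          ∫⁻ ω, runTime (wordLength c n σ) ω pre (preInit k l A) ∂(tapeLaw (wordLength c n σ)) ≤
            (polylog C n : ℝ≥0∞) * n * k / l) ∧
        ∀ A B : Fin n → Fin σ,
          -- every query takes time `Õ(k ^ 2 / l)`
          (∀ (ω : Tape (wordLength c n σ)) (DA DB : ℕ → ℕ),
            PreOut (wordLength c n σ) ω pre k l A DA →
            PreOut (wordLength c n σ) ω pre k l B DB →
              ∃ t s, Exec (wordLength c n σ) ω query (queryInit k l A B DA DB) t s ∧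
                (t : ℝ) ≤ (polylog C n : ℝ) * (k : ℝ) ^ 2 / (l : ℝ)) ∧
          -- close strings are reported SMALL
          ((editDist A B : ℝ) ≤ (k : ℝ) / (polylog C n : ℝ) →
            1 - 1 / (n : ℝ≥0∞) ≤ tapeLaw (wordLength c n σ)
              {ω | Answers (wordLength c n σ) ω pre query k l A B 1}) ∧
          -- far strings are reported LARGE
          ((C : ℝ) * k * l ≤ (editDist A B : ℝ) →
            1 - 1 / (n : ℝ≥0∞) ≤ tapeLaw (wordLength c n σ)
              {ω | Answers (wordLength c n σ) ω pre query k l A B 0}) := by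
  refine ⟨32, 2000, preprocess, query, by norm_num, by norm_num, query_deterministic,
    fun n k l σ hl hlk hkn => ?_⟩
  have sizes (A : Fin n → Fin σ) := sizes_wordLength hl hlk hkn (A ⟨0, by omega⟩).pos
  refine ⟨fun A => lintegral_runTime_preprocess_le (sizes A) A, fun A B =>
    ⟨fun _ _ _ => exec_query_of_preOut (sizes A), fun hclose => ?_, fun hfar => ?_⟩⟩
  · refine one_sub_le_tapeLaw_answers_one (sizes A) ?_
    have hpolylog := le_polylog (C := 2000) (by norm_num) n
    rw [le_div_iff₀ (by exact_mod_cast (by omega : 0 < polylog 2000 n))] at hclose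
    have hclose : editDist A B * polylog 2000 n ≤ k := by exact_mod_cast hclose
    calc 3 * editDist A B * (Nat.log 2 n + 1) = editDist A B * (3 * (Nat.log 2 n + 1)) := by ring
      _ ≤ editDist A B * polylog 2000 n := Nat.mul_le_mul_left _ (by omega)
      _ ≤ k := hclose
  · refine one_sub_le_tapeLaw_answers_zero (sizes A) ?_
    have hfar : 2000 * k * l ≤ editDist A B := by exact_mod_cast hfar
    have hkl : 0 < k * l := Nat.mul_pos (by omega) hl
    rw [mul_assoc] at hfar ⊢
    omega
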